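/- **Setting.** Consider an episodic Markov decision process with measurable observation space $\mathcal X$, measurable action space $\mathcal A$, horizon $H\ge 1$, fixed initial state $x_1$, transition kernels $P_h:\mathcal X\times\mathcal A\to\Delta(\mathcal X)$ and conditional cost distributions $C_h:\mathcal X\times\mathcal A\to\Delta([0,1])$, $h\in[H]$. For a policy $\pi=(\pi_h:\mathcal X\to\Delta(\mathcal A))_h$, let $V^\pi$ be the expected total cost $\mathbb E[\sum_{h=1}^H c_h]$ of rolling in $\pi$ from $x_1$, let $d_h^\pi$ be the law of $(x_h,a_h)$ under $\pi$, write $f(x,\pi_h)=\mathbb E_{a\sim\pi_h(x)}f(x,a)$, and let $\mathcal T^\pi_hf(x,a)=\mathbb E_{c\sim C_h(x,a),\,x'\sim P_h(x,a)}[c+f(x',\pi_{h+1})]$. Let $\mathcal F=\mathcal F_1\times\dots\times\mathcal F_H$ be a non-empty product of finite classes of measurable functions $\mathcal X\times\mathcal A\to[0,1]$, with the convention $f_{H+1}=0$ for $f\in\mathcal F$. For $f\in\mathcal F$ let $\pi_f$ be the greedy policy $\pi_{f,h}(x)=\arg\min_a f_h(x,a)$ (minima are assumed to be attained, and are selected measurably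 by a fixed tie-breaking rule that depends only on $h$, $f_h$ and $x$), and let $\Pi_{\mathcal F}=\{\pi_f:f\in\mathcal F\}$. Assume policy-wise Bellman completeness: $\mathcal T_h^\pi f_{h+1}\in\mathcal F_h$ for all $h\in[H]$, $f\in\mathcal F$ and $\pi\in\Pi_{\mathcal F}$. **Data.** The dataset is $\mathcal D=(\mathcal D_1,\dots,\mathcal D_H)$, where $\mathcal D_h$ consists of $n\ge1$ i.i.d. samples $(x_{h,i},a_{h,i},c_{h,i},x'_{h,i})$ with $(x_{h,i},a_{h,i})\sim\nu_h$, $c_{h,i}\sim C_h(x_{h,i},a_{h,i})$, $x'_{h,i}\sim P_h(x_{h,i},a_{h,i})$. The single-policy coverage coefficient is $C^{\pi}=\max_{h\in[H]}\|\mathrm d d_h^{\pi}/\mathrm d\nu_h\|_\infty$ (the $\nu_h$-essential supremum), with $C^\pi=\infty$ if some $d_h^\pi$ is not absolutely continuous with respect to $\nu_h$. **Algorithm (pessimistic offline RL, loss $\ell$, threshold $\beta$).** Let $\tau_h^\pi(g,c,x')=c+g(x',\pi_{h+1})$ and $L_h^\ell(p,g,\pi)=\sum_{i=1}^n\ell\big(p(x_{h,i},a_{h,i}),\tau_h^\pi(g,c_{h,i},x_{h,i}')\big)$.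 For each $\pi\in\Pi_{\mathcal F}$ form the version space $$\mathcal F_\pi=\Big\{f\in\mathcal F:\ \forall h\in[H],\ L_h^\ell(f_h,f_{h+1},\pi)\le\min_{g\in\mathcal F_h}L_h^\ell(g,f_{h+1},\pi)+\beta\Big\}$$ and choose $f^\pi\in\arg\max_{f\in\mathcal F_\pi}f_1(x_1,\pi_1)$. Return any $\hat\pi\in\arg\min_{\pi\in\Pi_{\mathcal F}}f^\pi_1(x_1,\pi_1)$. **Theorem.** There is a universal constant $K>0$ such that, in every such setting, for every $\delta\in(0,1)$ and $\beta=2\ln(H|\mathcal F|/\delta)$, the following holds. 1. For the squared loss $\ell_{\rm sq}(\hat y,y)=(\hat y-y)^2$, with probability at least $1-\delta$ all version spaces $\mathcal F_\pi$, $\pi\in\Pi_{\mathcal F}$, are non-empty (so the algorithm has an output), and for every output $\hat\pi$ and every comparator $\tilde\pi\in\Pi_{\mathcal F}$ with $C^{\tilde\pi}<\infty$, $$V^{\hat\pi}-V^{\tilde\pi}\le K\,H\sqrt{\frac{C^{\tilde\pi}\beta}{n}} .$$ 2. For the binary cross-entropy loss $\ell_{\rm bce}(\hat y,y)=-y\ln\hat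 y-(1-y)\ln(1-\hat y)$ (with $\ln 0=-\infty$, $0\ln 0=0$), if the regression targets are normalized, i.e. $c+f_{h+1}(x',\pi_{h+1})\le1$ almost surely under the data distribution of step $h$ for all $h\in[H]$, $f\in\mathcal F$, $\pi\in\Pi_{\mathcal F}$, then with probability at least $1-\delta$ the same holds with $$V^{\hat\pi}-V^{\tilde\pi}\le K\left(H\sqrt{V^{\tilde\pi}\cdot\frac{C^{\tilde\pi}\beta}{n}}+H^2\,\frac{C^{\tilde\pi}\beta}{n}\right).$$ -/

import Mathlib

open MeasureTheory ProbabilityTheory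
open scoped ENNReal

universe u v w

noncomputable section

namespace OfflineRL

variable {X : Type u} {A : Type v} [MeasurableSpace X] [MeasurableSpace A]

/-- An episodic MDP with observation space `X` and action space `A`. Steps are numbered
`0, …, H - 1` for a horizon `H`; the kernels with index `≥ H` play no role. -/
structure MDP (X : Type u) (A : Type v) [MeasurableSpace X] [MeasurableSpace A] where
  /-- the fixed initial state -/
  init : X
  /-- transition kernels -/
  trans : ℕ → Kernel (X × A) X
  /-- conditional cost distributions -/
  cost : ℕ → Kernel (X × A) ℝ
  trans_markov : ∀ h, IsMarkovKernel (trans h)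
  cost_markov : ∀ h, IsMarkovKernel (cost h)
  /-- costs lie in `[0, 1]` -/
  cost_mem : ∀ h z, ∀ᵐ c ∂(cost h z), c ∈ Set.Icc (0 : ℝ) 1

attribute [instance] MDP.trans_markov MDP.cost_markov

/-- A policy: at each step, a Markov kernel from observations to actions. -/
structure Policy (X : Type u) (A : Type v) [MeasurableSpace X] [MeasurableSpace A] where
  act : ℕ → Kernel X A
  markov : ∀ h, IsMarkovKernel (act h)

attribute [instance] Policy.markov

/-- `f(x, π_h) = 𝔼_{a ∼ π_h(x)} f(x, a)`. -/
def Policy.avg (π : Policy X A) (h : ℕ) (f : X × A → ℝ) (x : X) : ℝ :=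
  ∫ a, f (x, a) ∂(π.act h x)

/-- Law of the cumulative cost of the `k` steps `h, …, h + k - 1` when the state-action pair at
step `h` is the argument and `π` acts afterwards: `c + Z'` with `c ∼ C_h(x, a)`,
`x' ∼ P_h(x, a)`, `a' ∼ π_{h+1}(x')` and `Z'` the cumulative cost of the remaining `k - 1` steps
from `(x', a')`. -/
def returnLaw (M : MDP X A) (π : Policy X A) : ℕ → ℕ → Kernel (X × A) ℝ
  | 0, _ => Kernel.const _ (Measure.dirac 0)
  | k + 1, h =>
    (M.cost h ×ₖ (returnLaw M π k (h + 1) ∘ₖ (Kernel.id ×ₖ π.act (h + 1)) ∘ₖ M.trans h)).map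
      (fun p : ℝ × ℝ => p.1 + p.2)

instance returnLaw_markov (M : MDP X A) (π : Policy X A) (k h : ℕ) :
    IsMarkovKernel (returnLaw M π k h) := by
  induction k generalizing h with
  | zero => unfold returnLaw; infer_instance
  | succ k ih =>
    unfold returnLaw
    have := ih (h + 1)
    exact Kernel.IsMarkovKernel.map _ (by fun_prop)

/-- `Q^π_h(x, a)`, the expected cumulative cost from step `h` on in an MDP with horizon `H`. -/
def qValue (M : MDP X A) (H : ℕ) (π : Policy X A) (h : ℕ) (z : X × A) : ℝ :=
  ∫ t, t ∂(returnLaw M π (H - h) h z)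

/-- `V^π`, the expected cumulative cost of `π` from the initial state. -/
def value (M : MDP X A) (H : ℕ) (π : Policy X A) : ℝ :=
  π.avg 0 (qValue M H π 0) M.init

/-- Law of the state `x_h` when `π` is rolled in from the initial state. -/
def stateLaw (M : MDP X A) (π : Policy X A) : ℕ → Measure X
  | 0 => Measure.dirac M.init
  | h + 1 => (stateLaw M π h ⊗ₘ π.act h).bind (M.trans h)

/-- The visitation distribution `d^π_h`: law of `(x_h, a_h)` when `π` is rolled in. -/
def visit (M : MDP X A) (π : Policy X A) (h : ℕ) : Measure (X × A) :=
  stateLaw M π h ⊗ₘ π.act h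

open Classical in
/-- Single-policy coverage coefficient `max_h ‖d d^π_h / d ν_h‖_∞`; it is `∞` if some `d^π_h` is
not absolutely continuous with respect to `ν_h`. -/
def coverage (M : MDP X A) (H : ℕ) (ν : ℕ → Measure (X × A)) (π : Policy X A) : ℝ≥0∞ :=
  ⨆ h : Fin H, if visit M π h ≪ ν h then essSup ((visit M π h).rnDeriv (ν h)) (ν h) else ∞

/-- The policy-specific Bellman operator
`(T^π_h f)(x, a) = 𝔼_{c ∼ C_h(x, a), x' ∼ P_h(x, a)} [c + f(x', π_{h+1})]`. -/
def bellman (M : MDP X A) (π : Policy X A) (h : ℕ) (f : X × A → ℝ) (z : X × A) : ℝ :=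
  ∫ s, (s.1 + π.avg (h + 1) f s.2) ∂((M.cost h ×ₖ M.trans h) z)

/-- Law of a transition tuple `((x, a), (c, x'))` collected at step `h`: `(x, a) ∼ ν_h`,
`c ∼ C_h(x, a)`, `x' ∼ P_h(x, a)`. -/
def dataLaw (M : MDP X A) (ν : ℕ → Measure (X × A)) (h : ℕ) : Measure ((X × A) × (ℝ × X)) :=
  ν h ⊗ₘ (M.cost h ×ₖ M.trans h)

/-- The tuples `f = (f_0, …, f_{H-1})` of the product class `F_0 × ⋯ × F_{H-1}`, with the
convention that `f_h = 0` for `h ≥ H`. -/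
def tuples (H : ℕ) (F : ℕ → Finset (X × A → ℝ)) : Set (ℕ → X × A → ℝ) :=
  {f | (∀ h < H, f h ∈ F h) ∧ ∀ h, H ≤ h → f h = 0}

/-- The cardinality of the product class `F_0 × ⋯ × F_{H-1}`. -/
def classCard (H : ℕ) (F : ℕ → Finset (X × A → ℝ)) : ℕ :=
  ∏ h ∈ Finset.range H, (F h).card

/-- A rule which picks `argmin_a f_h(x, a)` measurably, with some fixed way of breaking ties. -/
structure GreedyRule (H : ℕ) (F : ℕ → Finset (X × A → ℝ)) where
  sel : ℕ → (X × A → ℝ) → X → A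
  measurable_sel : ∀ h f, Measurable (sel h f)
  sel_le : ∀ h < H, ∀ f ∈ F h, ∀ x a, f (x, sel h f x) ≤ f (x, a)

variable {H : ℕ} {F : ℕ → Finset (X × A → ℝ)}

/-- The greedy policy `π_f`. -/
def GreedyRule.policy (G : GreedyRule H F) (f : ℕ → X × A → ℝ) : Policy X A where
  act h := Kernel.deterministic (G.sel h (f h)) (G.measurable_sel h (f h))
  markov _ := inferInstance

/-- The class of greedy policies `Π_F = {π_f : f ∈ F}`. -/
def GreedyRule.policies (G : GreedyRule H F) : Set (Policy X A) :=
  G.policy '' tuples H F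

/-- Policy-wise Bellman completeness of the class `F` for the policies in `Pi`. -/
def BellmanComplete (M : MDP X A) (H : ℕ) (F : ℕ → Finset (X × A → ℝ))
    (Pi : Set (Policy X A)) : Prop :=
  ∀ π ∈ Pi, ∀ f ∈ tuples H F, ∀ h < H, bellman M π h (f (h + 1)) ∈ F h

/-- The squared loss `(ŷ - y)²`. -/
def sqLoss (p y : ℝ) : EReal := (((p - y) ^ 2 : ℝ) : EReal)

/-- The binary cross-entropy loss `- y ln ŷ - (1 - y) ln (1 - ŷ)`, with `ln 0 = -∞` and
`0 · ln 0 = 0`. -/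
def bceLoss (p y : ℝ) : EReal :=
  -((y : EReal) * ENNReal.log (ENNReal.ofReal p)) -
    (((1 - y : ℝ) : EReal) * ENNReal.log (ENNReal.ofReal (1 - p)))

/-- The regression target `τ^π(g, c, x') = c + g(x', π_{h+1})` of a transition at step `h`. -/
def target (π : Policy X A) (h : ℕ) (g : X × A → ℝ) (s : (X × A) × (ℝ × X)) : ℝ :=
  s.2.1 + π.avg (h + 1) g s.2.2

/-- The empirical risk `L_h^ℓ(p, g, D_h, π)`. -/
def empRisk {n : ℕ} (loss : ℝ → ℝ → EReal) (π : Policy X A) (h : ℕ) (p g : X × A → ℝ)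
    (D : Fin n → (X × A) × (ℝ × X)) : EReal :=
  ∑ i, loss (p (D i).1) (target π h g (D i))

/-- The version space of the policy `π` for the dataset `D = (D_0, …, D_{H-1})`. -/
def versionSpace {n : ℕ} (loss : ℝ → ℝ → EReal) (β : ℝ) (H : ℕ)
    (F : ℕ → Finset (X × A → ℝ)) (D : ℕ → Fin n → (X × A) × (ℝ × X)) (π : Policy X A) :
    Set (ℕ → X × A → ℝ) :=
  {f | f ∈ tuples H F ∧ ∀ h < H,
    empRisk loss π h (f h) (f (h + 1)) (D h) ≤
      (⨅ g ∈ F h, empRisk loss π h g (f (h + 1)) (D h)) + (β : EReal)}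

/-- `πhat` is a possible output of pessimistic offline RL with policy class `Pi`: for every
`π ∈ Pi` some `f^π` maximizing `f_0(x_init, π)` over the version space of `π` is chosen, and
`πhat` minimizes `f^π_0(x_init, π)` over `Pi`. -/
def IsOutput {n : ℕ} (M : MDP X A) (loss : ℝ → ℝ → EReal) (β : ℝ) (H : ℕ)
    (F : ℕ → Finset (X × A → ℝ)) (Pi : Set (Policy X A))
    (D : ℕ → Fin n → (X × A) × (ℝ × X)) (πhat : Policy X A) : Prop :=
  ∃ fsel : Policy X A → ℕ → X × A → ℝ,
    (∀ π ∈ Pi, IsMaxOn (fun f => π.avg 0 (f 0) M.init)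
        (versionSpace loss β H F D π) (fsel π) ∧ fsel π ∈ versionSpace loss β H F D π) ∧
    πhat ∈ Pi ∧ IsMinOn (fun π => π.avg 0 (fsel π 0) M.init) Pi πhat

end OfflineRL

end

open OfflineRL

/-! Outside an event of probability δ two things hold (`GoodEvent`): every version space contains
the true Q^π, and every member of a version space has small Bellman error under ν_h. Realizability
of Q^π comes from completeness (`qValue_mem_tuples`). Pessimism then bounds V of the output by
f_0(x_1, π̃) for some f in the version space of the comparator π̃ (`IsOutput.exists_value_le`). The
overestimation of V^π̃ by f telescopes into Bellman errors averaged over the visitation laws of π̃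
alone, and coverage transfers these to ν_h.

The good event rests on one Chernoff argument (`measure_exp_le_prod_le`). The Bellman backup is the
conditional mean of the regression target, so the exponentiated excess loss has a controlled
one-sample expectation: by Hoeffding's lemma for the squared loss (`lintegral_exp_excess_sq_le`), by
the Hellinger affinity for cross-entropy (`lintegral_bceRatio_le`). The backup loses to a given
competitor by more than β with probability at most exp(-β/2); a competitor with large error stays
within β of it with probability at most exp(-3β/2).

Since exp(-β/2) = δ/(H|F|), the union bound cannot afford all pairs (policy, competitor). But the
step-h regression problem for Q^{π_f} involves only the coordinates of f after h, so f_h is free to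
name the competitor, and |F| events per step suffice. One of them is empty, and the δ/|F| saved pays
for the |F|² events of the second kind (`measure_not_goodEvent_le`).

For the squared loss, Cauchy-Schwarz finishes. For cross-entropy, the error at a step is a Hellinger
distance weighted by the means of f_h and its backup (`abs_integral_sub_le_hellErr`). These means
are at most V^π̃ plus the total error, and the resulting quadratic inequality for the total error
gives the first-order rate (`first_order_bound`). -/

noncomputable section

namespace OfflineRL

/-! ### Integrals of bounded functions -/

section Integral

variable {α β : Type*} [MeasurableSpace α] [MeasurableSpace β]

theorem integrable_of_abs_le {μ : Measure α} [IsFiniteMeasure μ] {f : α → ℝ} (hf : Measurable f)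
    {b : ℝ} (hb : ∀ z, |f z| ≤ b) : Integrable f μ :=
  Integrable.of_bound hf.aestronglyMeasurable b (ae_of_all _ hb)

theorem measurable_integral_kernel (κ : Kernel α β) {f : β → ℝ} (hf : Measurable f) :
    Measurable fun z => ∫ y, f y ∂κ z :=
  (hf.stronglyMeasurable.integral_kernel (κ := κ)).measurable

theorem abs_integral_le_of_abs_le {μ : Measure α} [IsProbabilityMeasure μ] {f : α → ℝ}
    {b : ℝ} (hb : ∀ z, |f z| ≤ b) : |∫ z, f z ∂μ| ≤ b := by
  have := norm_integral_le_of_norm_le_const (μ := μ) (f := f) (C := b) (ae_of_all _ hb)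
  simpa using this

theorem integral_bind_kernel {μ : Measure α} [IsProbabilityMeasure μ] (κ : Kernel α β)
    [IsMarkovKernel κ] {f : β → ℝ} (hf : Measurable f) {b : ℝ} (hb : ∀ z, |f z| ≤ b) :
    ∫ y, f y ∂(μ.bind κ) = ∫ z, ∫ y, f y ∂κ z ∂μ := by
  have h := Kernel.integral_comp (a := ()) (κ := Kernel.const Unit μ) (η := κ) (f := f)
    (integrable_of_abs_le hf hb)
  simpa [Kernel.comp_apply] using h

theorem integral_mul_le_sqrt_mul_sqrt {μ : Measure α} [IsFiniteMeasure μ] {f g : α → ℝ}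
    (hf : Measurable f) (hg : Measurable g) (hf0 : ∀ z, 0 ≤ f z) (hg0 : ∀ z, 0 ≤ g z)
    {a b : ℝ} (hfa : ∀ z, f z ≤ a) (hgb : ∀ z, g z ≤ b) :
    ∫ z, f z * g z ∂μ ≤ √(∫ z, f z ^ 2 ∂μ) * √(∫ z, g z ^ 2 ∂μ) := by
  have := integral_mul_le_Lp_mul_Lq_of_nonneg (μ := μ) Real.HolderConjugate.two_two
    (ae_of_all _ hf0) (ae_of_all _ hg0)
    (MemLp.of_bound hf.aestronglyMeasurable a (ae_of_all _ fun z => by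
      rw [Real.norm_eq_abs, abs_of_nonneg (hf0 z)]; exact hfa z))
    (MemLp.of_bound hg.aestronglyMeasurable b (ae_of_all _ fun z => by
      rw [Real.norm_eq_abs, abs_of_nonneg (hg0 z)]; exact hgb z))
  simpa [Real.sqrt_eq_rpow] using this

theorem integral_le_mul_of_le_smul {μ ν : Measure α} [IsFiniteMeasure ν] {C : ℝ≥0∞} (hC : C ≠ ∞)
    (h : μ ≤ C • ν) {f : α → ℝ} (hf : Measurable f) (hf0 : ∀ z, 0 ≤ f z) {b : ℝ}
    (hb : ∀ z, f z ≤ b) : ∫ z, f z ∂μ ≤ C.toReal * ∫ z, f z ∂ν := by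
  have hi : Integrable f ν := integrable_of_abs_le hf (b := b) fun z => by
    rw [abs_of_nonneg (hf0 z)]; exact hb z
  have := integral_mono_measure h (ae_of_all _ hf0) (hi.smul_measure hC)
  rwa [integral_smul_measure, smul_eq_mul] at this

end Integral

/-! ### Value functions, visitation laws and coverage -/

section MarkovDecisionProcess

variable {X : Type u} {A : Type v} [MeasurableSpace X] [MeasurableSpace A]

theorem abs_avg_le (π : Policy X A) (h : ℕ) {f : X × A → ℝ} {b : ℝ} (hb : ∀ z, |f z| ≤ b)
    (x : X) : |π.avg h f x| ≤ b :=
  abs_integral_le_of_abs_le fun _ => hb _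

theorem measurable_avg (π : Policy X A) (h : ℕ) {f : X × A → ℝ} (hf : Measurable f) :
    Measurable (π.avg h f) :=
  (StronglyMeasurable.integral_kernel_prod_right (κ := π.act h) (f := fun x a => f (x, a))
    (by simpa [Function.uncurry_def] using hf.stronglyMeasurable)).measurable

theorem avg_mem_Icc (π : Policy X A) (h : ℕ) {f : X × A → ℝ} (hf : Measurable f) {a b : ℝ}
    (hb : ∀ z, f z ∈ Set.Icc a b) (x : X) : π.avg h f x ∈ Set.Icc a b := by
  have hi : Integrable (fun a => f (x, a)) (π.act h x) :=
    Integrable.of_mem_Icc a b (hf.comp (by fun_prop)).aemeasurable (ae_of_all _ fun _ => hb _)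
  constructor
  · have := integral_mono (μ := π.act h x) (integrable_const a) hi fun _ => (hb _).1
    simpa [Policy.avg] using this
  · have := integral_mono (μ := π.act h x) hi (integrable_const b) fun _ => (hb _).2
    simpa [Policy.avg] using this

/-- The mean cost of a state-action pair. -/
def meanCost (M : MDP X A) (h : ℕ) (z : X × A) : ℝ := ∫ c, c ∂(M.cost h z)

theorem integrable_cost (M : MDP X A) (h : ℕ) (z : X × A) :
    Integrable (fun c : ℝ => c) (M.cost h z) :=
  Integrable.of_mem_Icc 0 1 aemeasurable_id (M.cost_mem h z)

theorem measurable_meanCost (M : MDP X A) (h : ℕ) : Measurable (meanCost M h) :=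
  measurable_integral_kernel _ measurable_id

theorem meanCost_nonneg (M : MDP X A) (h : ℕ) (z : X × A) : 0 ≤ meanCost M h z :=
  integral_nonneg_of_ae ((M.cost_mem h z).mono fun _ hc => hc.1)

theorem abs_meanCost_le (M : MDP X A) (h : ℕ) (z : X × A) : |meanCost M h z| ≤ 1 := by
  have := norm_integral_le_of_norm_le_const (μ := M.cost h z) (f := fun c : ℝ => c) (C := 1)
    ((M.cost_mem h z).mono fun c hc => by rw [Real.norm_eq_abs, abs_of_nonneg hc.1]; exact hc.2)
  simpa [meanCost] using this

theorem integral_prod_add {α β : Type*} [MeasurableSpace α] [MeasurableSpace β] {μ : Measure α}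
    {ν : Measure β} [IsProbabilityMeasure μ] [IsProbabilityMeasure ν] {f : α → ℝ} {g : β → ℝ}
    (hf : Integrable f μ) (hg : Integrable g ν) :
    ∫ s, (f s.1 + g s.2) ∂(μ.prod ν) = ∫ a, f a ∂μ + ∫ b, g b ∂ν := by
  rw [integral_add (hf.comp_fst ν) (hg.comp_snd μ), integral_fun_fst, integral_fun_snd]
  simp

theorem bellman_eq (M : MDP X A) (π : Policy X A) (h : ℕ) {f : X × A → ℝ} (hf : Measurable f)
    {b : ℝ} (hb : ∀ z, |f z| ≤ b) (z : X × A) :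
    bellman M π h f z = meanCost M h z + ∫ x, π.avg (h + 1) f x ∂(M.trans h z) := by
  unfold bellman
  rw [Kernel.prod_apply, integral_prod_add (f := fun c => c) (integrable_cost M h z)
    (integrable_of_abs_le (measurable_avg π _ hf) (abs_avg_le π _ hb))]
  rfl

theorem ae_continuation_mem (M : MDP X A) (π : Policy X A) (h : ℕ) {κ : Kernel (X × A) ℝ}
    {s : Set ℝ} (hs : MeasurableSet s) (hκ : ∀ z, ∀ᵐ t ∂(κ z), t ∈ s) (z : X × A) :
    ∀ᵐ t ∂((κ ∘ₖ (Kernel.id ×ₖ π.act (h + 1)) ∘ₖ M.trans h) z), t ∈ s :=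
  Kernel.ae_comp_of_ae_ae hs (ae_of_all _ fun _ => Kernel.ae_comp_of_ae_ae hs (ae_of_all _ hκ))

theorem returnLaw_mem (M : MDP X A) (π : Policy X A) (k h : ℕ) (z : X × A) :
    ∀ᵐ t ∂(returnLaw M π k h z), t ∈ Set.Icc (0 : ℝ) k := by
  induction k generalizing h z with
  | zero =>
    simp [returnLaw]
  | succ k ih =>
    have hadd : Measurable (fun p : ℝ × ℝ => p.1 + p.2) := by fun_prop
    rw [returnLaw, Kernel.map_apply _ hadd]
    refine (ae_map_iff hadd.aemeasurable measurableSet_Icc).2 ?_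
    rw [Kernel.prod_apply]
    have h1 := (Measure.quasiMeasurePreserving_fst (μ := M.cost h z)
      (ν := (returnLaw M π k (h + 1) ∘ₖ (Kernel.id ×ₖ π.act (h + 1)) ∘ₖ M.trans h) z)).ae
        (M.cost_mem h z)
    have h2 := (Measure.quasiMeasurePreserving_snd (μ := M.cost h z)
      (ν := (returnLaw M π k (h + 1) ∘ₖ (Kernel.id ×ₖ π.act (h + 1)) ∘ₖ M.trans h) z)).ae
        (p := fun t => t ∈ Set.Icc (0 : ℝ) k)
        (ae_continuation_mem M π h measurableSet_Icc (ih (h + 1)) z)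
    filter_upwards [h1, h2] with p hp hq
    refine ⟨add_nonneg hp.1 hq.1, ?_⟩
    push_cast
    linarith [hp.2, hq.2]

theorem measurable_qValue (M : MDP X A) (H : ℕ) (π : Policy X A) (h : ℕ) :
    Measurable (qValue M H π h) :=
  measurable_integral_kernel _ measurable_id

theorem qValue_nonneg (M : MDP X A) (H : ℕ) (π : Policy X A) (h : ℕ) (z : X × A) :
    0 ≤ qValue M H π h z :=
  integral_nonneg_of_ae ((returnLaw_mem M π _ h z).mono fun _ ht => ht.1)

theorem abs_qValue_le (M : MDP X A) (H : ℕ) (π : Policy X A) (h : ℕ) (z : X × A) :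
    |qValue M H π h z| ≤ (H - h : ℕ) := by
  have := norm_integral_le_of_norm_le_const (μ := returnLaw M π (H - h) h z) (f := fun t : ℝ => t)
    (C := (H - h : ℕ)) ((returnLaw_mem M π _ h z).mono fun c hc => by
      rw [Real.norm_eq_abs, abs_of_nonneg hc.1]; exact hc.2)
  simpa [qValue] using this

theorem qValue_eq_zero (M : MDP X A) {H : ℕ} (π : Policy X A) {h : ℕ} (hh : H ≤ h) :
    qValue M H π h = 0 := by
  ext z
  simp [qValue, Nat.sub_eq_zero_of_le hh, returnLaw]

/-- Tower property for the return law; its support in [0, k] supplies all the integrability that is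
needed. -/
theorem qValue_eq_bellman (M : MDP X A) {H : ℕ} (π : Policy X A) {h : ℕ} (hh : h < H) :
    qValue M H π h = bellman M π h (qValue M H π (h + 1)) := by
  ext z
  obtain ⟨k, hk⟩ : ∃ k, H - h = k + 1 := ⟨H - h - 1, by omega⟩
  have hk' : H - (h + 1) = k := by omega
  have hadd : Measurable (fun p : ℝ × ℝ => p.1 + p.2) := by fun_prop
  have hmem : ∀ᵐ t ∂((returnLaw M π k (h + 1) ∘ₖ (Kernel.id ×ₖ π.act (h + 1)) ∘ₖ M.trans h) z),
      t ∈ Set.Icc (0 : ℝ) k :=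
    ae_continuation_mem M π h measurableSet_Icc (returnLaw_mem M π k (h + 1)) z
  have hint : Integrable (fun t : ℝ => t)
      ((returnLaw M π k (h + 1) ∘ₖ (Kernel.id ×ₖ π.act (h + 1)) ∘ₖ M.trans h) z) :=
    Integrable.of_mem_Icc 0 k aemeasurable_id hmem
  have hqb := abs_qValue_le M H π (h + 1)
  have hqm := measurable_qValue M H π (h + 1)
  rw [bellman_eq M π h hqm hqb, qValue, hk, returnLaw, Kernel.map_apply _ hadd,
    integral_map hadd.aemeasurable (by fun_prop), Kernel.prod_apply,
    integral_prod_add (f := fun c => c) (integrable_cost M h z) hint, Kernel.integral_comp hint]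
  congr 1
  refine integral_congr_ae (ae_of_all _ fun x => ?_)
  have hx : ∀ᵐ t ∂((returnLaw M π k (h + 1) ∘ₖ (Kernel.id ×ₖ π.act (h + 1))) x),
      t ∈ Set.Icc (0 : ℝ) k :=
    Kernel.ae_comp_of_ae_ae measurableSet_Icc (ae_of_all _ (returnLaw_mem M π k (h + 1)))
  have hq : (fun y => ∫ t, t ∂(returnLaw M π k (h + 1) y)) = qValue M H π (h + 1) := by
    ext y; rw [qValue, hk']
  beta_reduce
  rw [Kernel.integral_comp (f := fun t : ℝ => t) (Integrable.of_mem_Icc 0 k aemeasurable_id hx), hq,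
    Kernel.prod_apply, Kernel.id_apply, integral_prod _ (integrable_of_abs_le hqm hqb)]
  exact integral_dirac' _ _
    (StronglyMeasurable.integral_prod_right (ν := π.act (h + 1) x) hqm.stronglyMeasurable)

instance stateLaw_prob (M : MDP X A) (π : Policy X A) (h : ℕ) :
    IsProbabilityMeasure (stateLaw M π h) := by
  induction h with
  | zero => unfold stateLaw; infer_instance
  | succ h ih => unfold stateLaw; infer_instance

instance visit_prob (M : MDP X A) (π : Policy X A) (h : ℕ) :
    IsProbabilityMeasure (visit M π h) := by
  unfold visit; infer_instance

theorem integral_bellman_visit (M : MDP X A) (π : Policy X A) (h : ℕ) {f : X × A → ℝ}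
    (hf : Measurable f) {b : ℝ} (hb : ∀ z, |f z| ≤ b) :
    ∫ z, bellman M π h f z ∂(visit M π h) =
      ∫ z, meanCost M h z ∂(visit M π h) + ∫ z, f z ∂(visit M π (h + 1)) := by
  have hma := measurable_avg π (h + 1) hf
  have hba := abs_avg_le π (h + 1) hb
  simp_rw [bellman_eq M π h hf hb]
  rw [integral_add (integrable_of_abs_le (measurable_meanCost M h) (abs_meanCost_le M h))
    (integrable_of_abs_le (measurable_integral_kernel (M.trans h) hma)
      fun _ => abs_integral_le_of_abs_le hba)]
  congr 1
  rw [visit, visit, Measure.integral_compProd (f := f) (integrable_of_abs_le hf hb), stateLaw]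
  exact (integral_bind_kernel (M.trans h) hma hba).symm

theorem integral_visit_zero (M : MDP X A) (π : Policy X A) {f : X × A → ℝ}
    (hf : Measurable f) {b : ℝ} (hb : ∀ z, |f z| ≤ b) :
    ∫ z, f z ∂(visit M π 0) = π.avg 0 f M.init := by
  rw [visit, Measure.integral_compProd (integrable_of_abs_le hf hb), stateLaw]
  exact integral_dirac' _ _ (measurable_avg π 0 hf).stronglyMeasurable

/-- A finite coefficient forces absolute continuity, so the visitation law has a density, which is
almost everywhere below its essential supremum. -/
theorem visit_le_coverage_smul (M : MDP X A) {H : ℕ} {ν : ℕ → Measure (X × A)}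
    [∀ h, IsProbabilityMeasure (ν h)] {π : Policy X A} (hC : coverage M H ν π ≠ ∞) {h : ℕ}
    (hh : h < H) : visit M π h ≤ coverage M H ν π • ν h := by
  classical
  have hle := le_iSup (fun h : Fin H => if visit M π h ≪ ν h then
    essSup ((visit M π h).rnDeriv (ν h)) (ν h) else ∞) ⟨h, hh⟩
  simp only at hle
  have hac : visit M π h ≪ ν h := by
    by_contra hac
    rw [if_neg hac, top_le_iff] at hle
    apply hC
    unfold coverage
    convert hle
  rw [if_pos hac] at hle
  have hle' : essSup ((visit M π h).rnDeriv (ν h)) (ν h) ≤ coverage M H ν π := by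
    unfold coverage
    convert hle
  rw [← Measure.withDensity_rnDeriv_eq _ _ hac, ← withDensity_const]
  refine withDensity_mono ?_
  filter_upwards [ENNReal.ae_le_essSup ((visit M π h).rnDeriv (ν h))] with z hz
  exact hz.trans hle'

end MarkovDecisionProcess

/-! ### Telescoping and the self-bounding inequality, for real sequences -/

section RealSequences

/-- Here `A`, `B`, `U`, `c` stand for the means of f_h, of its backup T^π f_{h+1}, of Q^π_h and of
the cost under the step-h visitation law of π. Since `B` and `U` share the cost, A_h - U_h = (A_h -
B_h) + (A_{h+1} - U_{h+1}). -/
theorem sub_eq_sum_bellman_error {A B U c : ℕ → ℝ} {H : ℕ} (hA : A H = 0) (hU : U H = 0)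
    (hB : ∀ h < H, B h = c h + A (h + 1)) (hUc : ∀ h < H, U h = c h + U (h + 1))
    {h : ℕ} (hh : h ≤ H) : A h - U h = ∑ j ∈ Finset.Ico h H, (A j - B j) := by
  induction hh using Nat.decreasingInduction with
  | self => simp [hA, hU]
  | of_succ k hk ih =>
    rw [Finset.sum_eq_sum_Ico_succ_bot hk, ← ih, hB k hk, hUc k hk]
    ring

theorem sub_le_sum_abs_bellman_error {A B U c : ℕ → ℝ} {H : ℕ} (hA : A H = 0) (hU : U H = 0)
    (hB : ∀ h < H, B h = c h + A (h + 1)) (hUc : ∀ h < H, U h = c h + U (h + 1))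
    {h : ℕ} (hh : h ≤ H) : A h - U h ≤ ∑ j ∈ Finset.range H, |A j - B j| := by
  rw [sub_eq_sum_bellman_error hA hU hB hUc hh, Finset.range_eq_Ico]
  refine (Finset.sum_le_sum fun j _ => le_abs_self _).trans ?_
  exact Finset.sum_le_sum_of_subset_of_nonneg (Finset.Ico_subset_Ico_left (Nat.zero_le _))
    fun _ _ _ => abs_nonneg _

/-- The cross term 4H√S√ε is at most S/2 + 8H²ε, and S/2 is absorbed on the left. -/
theorem le_of_le_sqrt_add {S V ε H : ℝ} (hS : 0 ≤ S) (hV : 0 ≤ V) (hε : 0 ≤ ε) (hH : 0 ≤ H)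
    (h : S ≤ H * (4 * √((V + S) * ε))) : S ≤ 16 * (H * √(V * ε) + H ^ 2 * ε) := by
  have h1 : √((V + S) * ε) ≤ √(V * ε) + √S * √ε := by
    rw [← Real.sqrt_mul hS, add_mul]
    have h1 := Real.sq_sqrt (mul_nonneg hV hε)
    have h2 := Real.sq_sqrt (mul_nonneg hS hε)
    have h3 := mul_nonneg (Real.sqrt_nonneg (V * ε)) (Real.sqrt_nonneg (S * ε))
    exact Real.sqrt_le_iff.2 ⟨by positivity, by nlinarith⟩
  have h2 : 4 * H * (√S * √ε) ≤ S / 2 + 8 * H ^ 2 * ε := by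
    have := sq_nonneg (√S - 4 * H * √ε)
    have hS2 := Real.sq_sqrt hS
    have hε2 := Real.sq_sqrt hε
    nlinarith [this]
  have h3 : H * (4 * √((V + S) * ε)) ≤ H * (4 * (√(V * ε) + √S * √ε)) := by gcongr
  have h4 : 0 ≤ H * √(V * ε) := by positivity
  nlinarith

/-- Self-bounding: the sum S of the step errors also controls the means that weight each step error,
so S is bounded in terms of √(U_0 + S). -/
theorem first_order_bound {A B U c : ℕ → ℝ} {H : ℕ} {ε : ℝ} (hε : 0 ≤ ε)
    (hA : A H = 0) (hU : U H = 0) (hc : ∀ h, 0 ≤ c h) (hU0 : ∀ h, 0 ≤ U h)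
    (hB : ∀ h < H, B h = c h + A (h + 1)) (hUc : ∀ h < H, U h = c h + U (h + 1))
    (he : ∀ h < H, |A h - B h| ≤ √(2 * (A h + B h)) * √(4 * ε)) :
    A 0 - U 0 ≤ 16 * (H * √(U 0 * ε) + H ^ 2 * ε) := by
  set S := ∑ j ∈ Finset.range H, |A j - B j| with hS
  have hS0 : 0 ≤ S := Finset.sum_nonneg fun _ _ => abs_nonneg _
  have hle : ∀ h ≤ H, A h - U h ≤ S := fun h hh => sub_le_sum_abs_bellman_error hA hU hB hUc hh
  have hUV : ∀ h ≤ H, U h ≤ U 0 := by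
    intro h
    induction h with
    | zero => intro _; exact le_rfl
    | succ k ih =>
      intro hk
      have := ih (by omega)
      have := hUc k (by omega)
      have := hc k
      linarith
  refine (hle 0 (Nat.zero_le _)).trans (le_of_le_sqrt_add hS0 (hU0 0) hε (Nat.cast_nonneg _) ?_)
  calc S ≤ ∑ j ∈ Finset.range H, 4 * √((U 0 + S) * ε) := by
        refine Finset.sum_le_sum fun j hj => ?_
        have hj := Finset.mem_range.1 hj
        refine (he j hj).trans ?_
        -- A_j ≤ U_j + S, and B_j = c_j + A_{j+1} ≤ c_j + U_{j+1} + S = U_j + S; so 2(A_j + B_j) ·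
        -- 4ε ≤ 16(U_0 + S)ε.
        have h1 := hle j hj.le
        have h2 := hle (j + 1) hj
        have h3 := hUV j hj.le
        have h4 := hB j hj
        have h5 := hUc j hj
        have h6 : (4 : ℝ) * √((U 0 + S) * ε) = √(4 ^ 2 * ((U 0 + S) * ε)) := by
          rw [Real.sqrt_mul (x := 4 ^ 2) (by norm_num), Real.sqrt_sq (by norm_num)]
        rw [← Real.sqrt_mul' _ (by positivity), h6]
        refine Real.sqrt_le_sqrt ?_
        nlinarith
    _ = H * (4 * √((U 0 + S) * ε)) := by simp

end RealSequences

/-! ### The product class as a finite set -/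

section ProductClass

variable {X : Type u} {A : Type v} {H : ℕ} {F : ℕ → Finset (X × A → ℝ)}

open Classical in
/-- The tuples of the product class, as a finite set. -/
def tupleFinset (H : ℕ) (F : ℕ → Finset (X × A → ℝ)) : Finset (ℕ → X × A → ℝ) :=
  (Fintype.piFinset fun h : Fin H => F h).image fun f h => if hh : h < H then f ⟨h, hh⟩ else 0

theorem mem_tupleFinset {f : ℕ → X × A → ℝ} : f ∈ tupleFinset H F ↔ f ∈ tuples H F := by
  classical
  simp only [tupleFinset, Finset.mem_image, Fintype.mem_piFinset]
  constructor
  · rintro ⟨g, hg, rfl⟩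
    refine ⟨fun h hh => ?_, fun h hh => ?_⟩
    · simpa [hh] using hg ⟨h, hh⟩
    · simp [hh.not_gt]
  · intro hf
    refine ⟨fun h => f h, fun h => hf.1 h h.2, ?_⟩
    ext1 h
    by_cases hh : h < H
    · simp [hh]
    · simp [hh, hf.2 h (not_lt.1 hh)]

theorem card_tupleFinset_le : (tupleFinset H F).card ≤ classCard H F := by
  classical
  refine Finset.card_image_le.trans_eq ?_
  rw [Fintype.card_piFinset, classCard, Finset.prod_range]

theorem finite_tuples : (tuples H F).Finite :=
  (tupleFinset H F).finite_toSet.subset fun _ hf => mem_tupleFinset.2 hf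

theorem update_mem_tuples {f : ℕ → X × A → ℝ} (hf : f ∈ tuples H F) {h : ℕ} (hh : h < H)
    {g : X × A → ℝ} (hg : g ∈ F h) : Function.update f h g ∈ tuples H F := by
  refine ⟨fun j hj => ?_, fun j hj => ?_⟩
  · by_cases hjh : j = h
    · subst hjh; simpa using hg
    · rw [Function.update_of_ne hjh]; exact hf.1 j hj
  · rw [Function.update_of_ne (by omega)]; exact hf.2 j hj

theorem one_le_classCard (hne : (tuples H F).Nonempty) : 1 ≤ classCard H F := by
  obtain ⟨f, hf⟩ := hne
  exact Finset.one_le_prod' fun h hh =>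
    Finset.card_pos.2 ⟨f h, hf.1 h (Finset.mem_range.1 hh)⟩

theorem threshold_nonneg (hH : 0 < H) (hne : (tuples H F).Nonempty) {δ β : ℝ} (hδ0 : 0 < δ)
    (hδ1 : δ < 1) (hβ : β = 2 * Real.log (H * classCard H F / δ)) : 0 ≤ β := by
  rw [hβ]
  have h1 : (1 : ℝ) ≤ H := by exact_mod_cast hH
  have h2 : (1 : ℝ) ≤ classCard H F := by exact_mod_cast one_le_classCard hne
  refine mul_nonneg zero_le_two (Real.log_nonneg ?_)
  rw [one_le_div hδ0]
  nlinarith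

end ProductClass

/-! ### Classes with values in the unit interval, and realizability of Q^π -/

variable {X : Type u} {A : Type v} [MeasurableSpace X] [MeasurableSpace A]
variable {H : ℕ} {F : ℕ → Finset (X × A → ℝ)}

/-- The function classes consist of measurable functions with values in `[0, 1]`. -/
structure UnitClasses (H : ℕ) (F : ℕ → Finset (X × A → ℝ)) : Prop where
  meas : ∀ h < H, ∀ f ∈ F h, Measurable f
  mem : ∀ h < H, ∀ f ∈ F h, ∀ z, f z ∈ Set.Icc (0 : ℝ) 1

theorem UnitClasses.measurable (hF : UnitClasses H F) {f : ℕ → X × A → ℝ} (hf : f ∈ tuples H F)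
    (h : ℕ) : Measurable (f h) := by
  rcases lt_or_ge h H with hh | hh
  · exact hF.meas h hh _ (hf.1 h hh)
  · rw [hf.2 h hh]; exact measurable_const

theorem UnitClasses.mem_Icc (hF : UnitClasses H F) {f : ℕ → X × A → ℝ} (hf : f ∈ tuples H F)
    (h : ℕ) (z : X × A) : f h z ∈ Set.Icc (0 : ℝ) 1 := by
  rcases lt_or_ge h H with hh | hh
  · exact hF.mem h hh _ (hf.1 h hh) z
  · rw [hf.2 h hh]; simp

theorem UnitClasses.abs_le (hF : UnitClasses H F) {f : ℕ → X × A → ℝ} (hf : f ∈ tuples H F)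
    (h : ℕ) (z : X × A) : |f h z| ≤ 1 := by
  have := hF.mem_Icc hf h z
  rw [abs_of_nonneg this.1]; exact this.2

/-- Backward induction on the step. Completeness speaks of full tuples, so Q^π after step h is
completed by an arbitrary member `f₀` up to step h; the backup at h sees only coordinate h + 1. -/
theorem qValue_mem_tuples {M : MDP X A} (hne : (tuples H F).Nonempty) {Pi : Set (Policy X A)}
    (hBC : BellmanComplete M H F Pi) {π : Policy X A} (hπ : π ∈ Pi) :
    qValue M H π ∈ tuples H F := by
  obtain ⟨f₀, hf₀⟩ := hne
  refine ⟨fun h hh => ?_, fun h hh => qValue_eq_zero M π hh⟩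
  obtain ⟨k, hk⟩ : ∃ k, h + (k + 1) = H := ⟨H - h - 1, by omega⟩
  induction k using Nat.strong_induction_on generalizing h with
  | _ k ih =>
    have hmem : (fun j => if j ≤ h then f₀ j else qValue M H π j) ∈ tuples H F := by
      refine ⟨fun j hj => ?_, fun j hj => ?_⟩
      · dsimp only
        split_ifs with hjh
        · exact hf₀.1 j hj
        · exact ih (H - j - 1) (by omega) j hj (by omega)
      · dsimp only
        rw [if_neg (by omega), qValue_eq_zero M π hj]
    have := hBC π hπ _ hmem h hh
    rw [if_neg (by omega)] at this
    rwa [qValue_eq_bellman M π hh]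

/-! ### Version spaces and pessimism -/

section VersionSpace

variable {n : ℕ} {loss : ℝ → ℝ → EReal} {β : ℝ} {D : ℕ → Fin n → (X × A) × (ℝ × X)}

theorem mem_versionSpace_iff {π : Policy X A} {f : ℕ → X × A → ℝ} :
    f ∈ versionSpace loss β H F D π ↔ f ∈ tuples H F ∧ ∀ h < H, ∀ g ∈ F h,
      empRisk loss π h (f h) (f (h + 1)) (D h) ≤
        empRisk loss π h g (f (h + 1)) (D h) + (β : EReal) := by
  refine and_congr_right fun _ => forall₂_congr fun h _ => ?_
  have key : ∀ a b : EReal, a ≤ b + β ↔ a - β ≤ b := fun a b =>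
    (EReal.sub_le_iff_le_add (Or.inl (EReal.coe_ne_bot β)) (Or.inl (EReal.coe_ne_top β))).symm
  simp_rw [key, le_iInf_iff]

theorem exists_isOutput {M : MDP X A} {Pi : Set (Policy X A)} (hPf : Pi.Finite)
    (hPn : Pi.Nonempty) (hne : ∀ π ∈ Pi, (versionSpace loss β H F D π).Nonempty) :
    ∃ πhat, IsOutput M loss β H F Pi D πhat := by
  have hex : ∀ π, ∃ f, π ∈ Pi → IsMaxOn (fun f : ℕ → X × A → ℝ => π.avg 0 (f 0) M.init)
      (versionSpace loss β H F D π) f ∧ f ∈ versionSpace loss β H F D π := by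
    intro π
    by_cases hπ : π ∈ Pi
    · obtain ⟨f, hf, hmax⟩ := Set.exists_max_image (versionSpace loss β H F D π)
        (fun f : ℕ → X × A → ℝ => π.avg 0 (f 0) M.init)
        (finite_tuples.subset fun f hf => hf.1) (hne π hπ)
      exact ⟨f, fun _ => ⟨fun g hg => hmax g hg, hf⟩⟩
    · exact ⟨0, fun h => absurd h hπ⟩
  choose fsel hfsel using hex
  obtain ⟨πhat, hπ, hmin⟩ := Set.exists_min_image Pi
    (fun π => π.avg 0 (fsel π 0) M.init) hPf hPn
  exact ⟨πhat, fsel, hfsel, hπ, fun π hπ => hmin π hπ⟩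

/-- Pessimism: the selected f for the output policy dominates its true Q-function at the initial
state, and the output minimizes the selected values over the policies. -/
theorem IsOutput.exists_value_le {M : MDP X A} {Pi : Set (Policy X A)} {πhat : Policy X A}
    (hout : IsOutput M loss β H F Pi D πhat)
    (hq : ∀ π ∈ Pi, qValue M H π ∈ versionSpace loss β H F D π) {πc : Policy X A}
    (hπc : πc ∈ Pi) :
    ∃ f ∈ versionSpace loss β H F D πc, value M H πhat ≤ πc.avg 0 (f 0) M.init := by
  obtain ⟨fsel, hsel, hπ, hmin⟩ := hout
  refine ⟨fsel πc, (hsel πc hπc).2, ?_⟩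
  exact ((hsel πhat hπ).1 (hq πhat hπ)).trans (hmin hπc)

end VersionSpace

/-- Mean squared distance of two functions. -/
def sqErr (μ : Measure (X × A)) (p q : X × A → ℝ) : ℝ := ∫ z, (p z - q z) ^ 2 ∂μ

/-- Mean squared distance of the square roots of two functions. -/
def hellErr (μ : Measure (X × A)) (p q : X × A → ℝ) : ℝ := ∫ z, (√(p z) - √(q z)) ^ 2 ∂μ

/-! ### From Bellman errors under the visitation laws to overestimation -/

section Regret

variable {M : MDP X A} {π : Policy X A} {f : ℕ → X × A → ℝ}

theorem abs_integral_sub_le_sqErr {μ : Measure (X × A)} [IsProbabilityMeasure μ]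
    {p q : X × A → ℝ} (hp : Measurable p) (hq : Measurable q) (hp1 : ∀ z, p z ∈ Set.Icc (0 : ℝ) 1)
    (hq1 : ∀ z, q z ∈ Set.Icc (0 : ℝ) 1) :
    |∫ z, p z ∂μ - ∫ z, q z ∂μ| ≤ √(sqErr μ p q) := by
  rw [← integral_sub (Integrable.of_mem_Icc 0 1 hp.aemeasurable (ae_of_all _ hp1))
    (Integrable.of_mem_Icc 0 1 hq.aemeasurable (ae_of_all _ hq1))]
  refine abs_integral_le_integral_abs.trans ?_
  have := integral_mul_le_sqrt_mul_sqrt (μ := μ) (f := fun z => |p z - q z|) (g := fun _ => 1)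
    (a := 1) (b := 1) (by fun_prop) (by fun_prop) (fun _ => abs_nonneg _) (fun _ => zero_le_one)
    (fun z => by
      rw [abs_le]; constructor <;> linarith [(hp1 z).1, (hp1 z).2, (hq1 z).1, (hq1 z).2])
    (fun _ => le_rfl)
  simpa [sqErr] using this

/-- Factor |p - q| = (√p + √q)|√p - √q|, apply Cauchy-Schwarz, and use (√p + √q)² ≤ 2(p + q). Small
means thus give a smaller error. -/
theorem abs_integral_sub_le_hellErr {μ : Measure (X × A)} [IsProbabilityMeasure μ]
    {p q : X × A → ℝ} (hp : Measurable p) (hq : Measurable q) (hp1 : ∀ z, p z ∈ Set.Icc (0 : ℝ) 1)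
    (hq1 : ∀ z, q z ∈ Set.Icc (0 : ℝ) 1) :
    |∫ z, p z ∂μ - ∫ z, q z ∂μ| ≤
      √(2 * (∫ z, p z ∂μ + ∫ z, q z ∂μ)) * √(hellErr μ p q) := by
  have hpi := Integrable.of_mem_Icc (μ := μ) 0 1 hp.aemeasurable (ae_of_all _ hp1)
  have hqi := Integrable.of_mem_Icc (μ := μ) 0 1 hq.aemeasurable (ae_of_all _ hq1)
  have sp : ∀ z, √(p z) ∈ Set.Icc (0 : ℝ) 1 := fun z =>
    ⟨Real.sqrt_nonneg _, Real.sqrt_le_one.2 (hp1 z).2⟩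
  have sq : ∀ z, √(q z) ∈ Set.Icc (0 : ℝ) 1 := fun z =>
    ⟨Real.sqrt_nonneg _, Real.sqrt_le_one.2 (hq1 z).2⟩
  rw [← integral_sub hpi hqi, ← integral_add hpi hqi, ← integral_const_mul]
  refine abs_integral_le_integral_abs.trans ?_
  have hsum : ∀ z, 0 ≤ √(p z) + √(q z) := fun z => by positivity
  have key := integral_mul_le_sqrt_mul_sqrt (μ := μ) (f := fun z => √(p z) + √(q z))
    (g := fun z => |√(p z) - √(q z)|)
    (a := 2) (b := 1) (by fun_prop) (by fun_prop) hsum (fun _ => abs_nonneg _)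
    (fun z => by linarith [(sp z).2, (sq z).2])
    (fun z => by
      rw [abs_le]; constructor <;> linarith [(sp z).1, (sp z).2, (sq z).1, (sq z).2])
  simp only [sq_abs] at key
  calc ∫ z, |p z - q z| ∂μ = ∫ z, (√(p z) + √(q z)) * |√(p z) - √(q z)| ∂μ := by
        refine integral_congr_ae (ae_of_all _ fun z => ?_)
        have h1 := Real.sq_sqrt (hp1 z).1
        have h2 := Real.sq_sqrt (hq1 z).1
        beta_reduce
        nth_rewrite 1 [← abs_of_nonneg (hsum z)]
        rw [← abs_mul]
        congr 1
        linear_combination h2 - h1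
    _ ≤ _ := key
    _ ≤ _ := by
        rw [hellErr]
        refine mul_le_mul_of_nonneg_right (Real.sqrt_le_sqrt ?_) (Real.sqrt_nonneg _)
        refine integral_mono ?_ ((hpi.add hqi).const_mul 2) fun z => ?_
        · refine integrable_of_abs_le (b := 4) (by fun_prop) fun z => ?_
          rw [abs_of_nonneg (sq_nonneg _)]
          nlinarith [(sp z).1, (sp z).2, (sq z).1, (sq z).2]
        · have h1 := Real.sq_sqrt (hp1 z).1
          have h2 := Real.sq_sqrt (hq1 z).1
          nlinarith [sq_nonneg (√(p z) - √(q z))]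

theorem value_eq_integral_visit (M : MDP X A) (H : ℕ) (π : Policy X A) :
    value M H π = ∫ z, qValue M H π 0 z ∂(visit M π 0) :=
  (integral_visit_zero M π (measurable_qValue M H π 0) (abs_qValue_le M H π 0)).symm

theorem integral_qValue_visit (M : MDP X A) (π : Policy X A) {h : ℕ} (hh : h < H) :
    ∫ z, qValue M H π h z ∂(visit M π h) = ∫ z, meanCost M h z ∂(visit M π h) +
      ∫ z, qValue M H π (h + 1) z ∂(visit M π (h + 1)) := by
  rw [qValue_eq_bellman M π hh,
    integral_bellman_visit M π h (measurable_qValue M H π _) (abs_qValue_le M H π _)]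

theorem avg_sub_value_le_of_sqErr (hF : UnitClasses H F) (hf : f ∈ tuples H F)
    (hT : ∀ h < H, bellman M π h (f (h + 1)) ∈ F h) {ε : ℝ}
    (he : ∀ h < H, sqErr (visit M π h) (f h) (bellman M π h (f (h + 1))) ≤ ε) :
    π.avg 0 (f 0) M.init - value M H π ≤ H * √ε := by
  rw [← integral_visit_zero M π (hF.measurable hf 0) (hF.abs_le hf 0), value_eq_integral_visit]
  refine (sub_le_sum_abs_bellman_error (H := H) (A := fun h => ∫ z, f h z ∂(visit M π h))
    (B := fun h => ∫ z, bellman M π h (f (h + 1)) z ∂(visit M π h))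
    (U := fun h => ∫ z, qValue M H π h z ∂(visit M π h))
    (c := fun h => ∫ z, meanCost M h z ∂(visit M π h)) ?_ ?_
    (fun h _ => integral_bellman_visit M π h (hF.measurable hf _) (hF.abs_le hf _))
    (fun h hh => integral_qValue_visit M π hh) (Nat.zero_le _)).trans ?_
  · simp [hf.2 H le_rfl]
  · simp [qValue_eq_zero M π le_rfl]
  · refine (Finset.sum_le_sum fun h hh => ?_).trans_eq (b := ∑ h ∈ Finset.range H, √ε) (by simp)
    have hh := Finset.mem_range.1 hh
    exact (abs_integral_sub_le_sqErr (hF.measurable hf h) (hF.meas h hh _ (hT h hh))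
      (hF.mem_Icc hf h) (hF.mem h hh _ (hT h hh))).trans (Real.sqrt_le_sqrt (he h hh))

theorem avg_sub_value_le_of_hellErr (hF : UnitClasses H F) (hf : f ∈ tuples H F)
    (hT : ∀ h < H, bellman M π h (f (h + 1)) ∈ F h) {ε : ℝ} (hε : 0 ≤ ε)
    (he : ∀ h < H, hellErr (visit M π h) (f h) (bellman M π h (f (h + 1))) ≤ 4 * ε) :
    π.avg 0 (f 0) M.init - value M H π ≤
      16 * (H * √(value M H π * ε) + H ^ 2 * ε) := by
  rw [← integral_visit_zero M π (hF.measurable hf 0) (hF.abs_le hf 0), value_eq_integral_visit]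
  refine first_order_bound (A := fun h => ∫ z, f h z ∂(visit M π h))
    (B := fun h => ∫ z, bellman M π h (f (h + 1)) z ∂(visit M π h))
    (U := fun h => ∫ z, qValue M H π h z ∂(visit M π h))
    (c := fun h => ∫ z, meanCost M h z ∂(visit M π h)) hε ?_ ?_
    (fun h => integral_nonneg (meanCost_nonneg M h))
    (fun h => integral_nonneg (qValue_nonneg M H π h))
    (fun h _ => integral_bellman_visit M π h (hF.measurable hf _) (hF.abs_le hf _))
    (fun h hh => integral_qValue_visit M π hh) fun h hh => ?_
  · simp [hf.2 H le_rfl]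
  · simp [qValue_eq_zero M π le_rfl]
  · refine (abs_integral_sub_le_hellErr (hF.measurable hf h) (hF.meas h hh _ (hT h hh))
      (hF.mem_Icc hf h) (hF.mem h hh _ (hT h hh))).trans ?_
    exact mul_le_mul_of_nonneg_left (Real.sqrt_le_sqrt (he h hh)) (Real.sqrt_nonneg _)

end Regret

/-! ### Sums of extended reals -/

section ERealSums

theorem ereal_sum_coe {ι : Type*} (s : Finset ι) (f : ι → ℝ) :
    ∑ i ∈ s, (f i : EReal) = ((∑ i ∈ s, f i : ℝ) : EReal) := by
  classical
  induction s using Finset.induction with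
  | empty => simp
  | insert i s hi ih => rw [Finset.sum_insert hi, Finset.sum_insert hi, ih, EReal.coe_add]

theorem ereal_sum_eq_top {ι : Type*} {s : Finset ι} {f : ι → EReal} (hbot : ∀ i ∈ s, f i ≠ ⊥)
    {i : ι} (hi : i ∈ s) (htop : f i = ⊤) : ∑ i ∈ s, f i = ⊤ := by
  classical
  have hne : ∀ t ⊆ s, ∑ j ∈ t, f j ≠ ⊥ := by
    intro t
    induction t using Finset.induction with
    | empty => simp
    | insert j t hj ih =>
      intro hsub
      rw [Finset.sum_insert hj]
      exact EReal.add_ne_bot_iff.2 ⟨hbot j (hsub (Finset.mem_insert_self _ _)),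
        ih ((Finset.subset_insert _ _).trans hsub)⟩
  rw [← Finset.add_sum_erase s f hi, htop,
    EReal.top_add_of_ne_bot (hne _ (Finset.erase_subset _ _))]

end ERealSums

/-! ### Exponentiated excess losses, with infinite values allowed -/

section LossRatio

variable {Z S : Type*} {n : ℕ} {Y : S → ℝ} {m p : Z → ℝ}

/-- `φ` is the likelihood ratio `exp (lam * (ℓ₀ - ℓ))` of two losses which are finite, or `∞` for
the second one. -/
def IsLossRatio (lam : ℝ) (φ : Z → ℝ≥0∞) (ℓ₀ ℓ : Z → EReal) (s : Z) : Prop :=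
  ∃ a : ℝ, ℓ₀ s = a ∧ (ℓ s = ⊤ ∨ ∃ b : ℝ, ℓ s = b ∧ φ s = ENNReal.ofReal (Real.exp (lam * (a - b))))

/-- No term is -∞, so one infinite loss makes the whole sum infinite; otherwise the exponents add
up. -/
theorem prod_eq_of_isLossRatio {lam : ℝ} {φ : Z → ℝ≥0∞} {ℓ₀ ℓ : Z → EReal} {d : Fin n → Z}
    (h : ∀ i, IsLossRatio lam φ ℓ₀ ℓ (d i)) :
    ∃ a : ℝ, ∑ i, ℓ₀ (d i) = a ∧ (∑ i, ℓ (d i) = ⊤ ∨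
      ∃ b : ℝ, ∑ i, ℓ (d i) = b ∧ ∏ i, φ (d i) = ENNReal.ofReal (Real.exp (lam * (a - b)))) := by
  choose a ha hb using h
  refine ⟨∑ i, a i, by simp_rw [ha, ereal_sum_coe], ?_⟩
  by_cases htop : ∃ i, ℓ (d i) = ⊤
  · obtain ⟨i, hi⟩ := htop
    left
    refine ereal_sum_eq_top (fun j _ => ?_) (Finset.mem_univ i) hi
    rcases hb j with h | ⟨b, h, -⟩ <;> rw [h] <;> simp
  · right
    have hb' : ∀ i, ∃ b : ℝ, ℓ (d i) = b ∧
        φ (d i) = ENNReal.ofReal (Real.exp (lam * (a i - b))) := fun i =>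
      (hb i).resolve_left fun h => htop ⟨i, h⟩
    choose b hb hφ using hb'
    refine ⟨∑ i, b i, by simp_rw [hb, ereal_sum_coe], ?_⟩
    simp_rw [hφ]
    rw [← ENNReal.ofReal_prod_of_nonneg fun i _ => (Real.exp_pos _).le, ← Real.exp_sum,
      ← Finset.mul_sum, Finset.sum_sub_distrib]

/-- The exponentiated excess squared loss. -/
def sqRatio (lam : ℝ) (Y : S → ℝ) (m p : Z → ℝ) (s : Z × S) : ℝ≥0∞ :=
  ENNReal.ofReal (Real.exp (lam * ((m s.1 - Y s.2) ^ 2 - (p s.1 - Y s.2) ^ 2)))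

/-- The square root of the likelihood ratio of the cross-entropy losses. -/
def bceRatio (Y : S → ℝ) (m p : Z → ℝ) (s : Z × S) : ℝ≥0∞ :=
  ENNReal.ofReal (√(p s.1 / m s.1) ^ Y s.2 * √((1 - p s.1) / (1 - m s.1)) ^ (1 - Y s.2))

theorem sqLoss_isLossRatio (lam : ℝ) (Y : S → ℝ) (m p : Z → ℝ) (s : Z × S) :
    IsLossRatio lam (sqRatio lam Y m p) (fun s => sqLoss (m s.1) (Y s.2))
      (fun s => sqLoss (p s.1) (Y s.2)) s :=
  ⟨_, rfl, Or.inr ⟨_, rfl, rfl⟩⟩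

theorem coe_mul_log_ofReal {y q : ℝ} (hy : 0 ≤ y) (hq : 0 ≤ q) :
    (y : EReal) * ENNReal.log (ENNReal.ofReal q) =
      if q = 0 ∧ y ≠ 0 then ⊥ else ((y * Real.log q : ℝ) : EReal) := by
  rcases hq.eq_or_lt with rfl | hq'
  · rcases hy.eq_or_lt with rfl | hy'
    · simp
    · simp [hy'.ne', EReal.coe_mul_bot_of_pos hy']
  · rw [ENNReal.log_ofReal_of_pos hq', if_neg fun h => hq'.ne' h.1, EReal.coe_mul]

theorem bceLoss_eq {q y : ℝ} (hq : q ∈ Set.Icc (0 : ℝ) 1) (hy : y ∈ Set.Icc (0 : ℝ) 1) :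
    bceLoss q y = if (q = 0 ∧ y ≠ 0) ∨ (1 - q = 0 ∧ 1 - y ≠ 0) then ⊤ else
      ((-(y * Real.log q) - (1 - y) * Real.log (1 - q) : ℝ) : EReal) := by
  rw [bceLoss, coe_mul_log_ofReal hy.1 hq.1,
    coe_mul_log_ofReal (sub_nonneg.2 hy.2) (sub_nonneg.2 hq.2)]
  by_cases h1 : q = 0 ∧ y ≠ 0 <;> by_cases h2 : 1 - q = 0 ∧ 1 - y ≠ 0
  · simp only [h1, h2, if_true, ne_eq, not_false_eq_true, and_self]
    simp
  · rw [if_pos h1, if_neg h2, if_pos (Or.inl h1), EReal.neg_bot, EReal.top_sub_coe]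
  · rw [if_neg h1, if_pos h2, if_pos (Or.inr h2), ← EReal.coe_neg, EReal.coe_sub_bot]
  · rw [if_neg h1, if_neg h2, if_neg (not_or.2 ⟨h1, h2⟩), EReal.coe_sub, EReal.coe_neg]

/-- For y = 0 both sides are 1 whatever `q / r` and the logarithms are; for y ≠ 0 the hypotheses
make q and r positive. -/
theorem sqrt_div_rpow_eq_exp {q r y : ℝ} (hq : 0 ≤ q) (hr : 0 ≤ r) (hqy : ¬(q = 0 ∧ y ≠ 0))
    (hry : r = 0 → y = 0) :
    √(q / r) ^ y = Real.exp (1 / 2 * (y * Real.log q - y * Real.log r)) := by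
  by_cases hy : y = 0
  · simp [hy]
  · have hq' : 0 < q := hq.lt_of_ne fun h => hqy ⟨h.symm, hy⟩
    have hr' : 0 < r := hr.lt_of_ne fun h => hy (hry h.symm)
    rw [Real.rpow_def_of_pos (Real.sqrt_pos.2 (div_pos hq' hr')),
      Real.log_sqrt (div_pos hq' hr').le, Real.log_div hq'.ne' hr'.ne']
    ring_nf

theorem bceLoss_isLossRatio {s : Z × S} (hm : m s.1 ∈ Set.Icc (0 : ℝ) 1)
    (hp : p s.1 ∈ Set.Icc (0 : ℝ) 1) (hy : Y s.2 ∈ Set.Icc (0 : ℝ) 1)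
    (h0 : m s.1 = 0 → Y s.2 = 0) (h1 : 1 - m s.1 = 0 → 1 - Y s.2 = 0) :
    IsLossRatio (1 / 2) (bceRatio Y m p) (fun s => bceLoss (m s.1) (Y s.2))
      (fun s => bceLoss (p s.1) (Y s.2)) s := by
  refine ⟨_, (bceLoss_eq hm hy).trans (if_neg ?_), ?_⟩
  · rintro (⟨h, h'⟩ | ⟨h, h'⟩)
    · exact h' (h0 h)
    · exact h' (h1 h)
  · beta_reduce
    rw [bceLoss_eq hp hy]
    split_ifs with h
    · exact Or.inl rfl
    · refine Or.inr ⟨_, rfl, ?_⟩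
      rw [not_or] at h
      rw [bceRatio, sqrt_div_rpow_eq_exp hp.1 hm.1 h.1 h0,
        sqrt_div_rpow_eq_exp (sub_nonneg.2 hp.2) (sub_nonneg.2 hm.2) h.2 h1, ← Real.exp_add]
      ring_nf

end LossRatio

/-! ### Chernoff bounds for empirical risks -/

section Chernoff

variable {Ω : Type*} {Z : Type*} [MeasurableSpace Ω] [MeasurableSpace Z] {μ : Measure Ω}
  {ρ : Measure Z} {n : ℕ} {D : Ω → Fin n → Z}

theorem measure_exp_le_prod_le [IsProbabilityMeasure μ] (hD : ∀ i, Measurable fun ω => D ω i)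
    (hlaw : ∀ i, μ.map (fun ω => D ω i) = ρ) (hind : iIndepFun (fun i ω => D ω i) μ)
    {φ : Z → ℝ≥0∞} (hφ : Measurable φ) {b : ℝ} (hb : ∫⁻ s, φ s ∂ρ ≤ ENNReal.ofReal (Real.exp (-b)))
    (t : ℝ) : μ {ω | ENNReal.ofReal (Real.exp t) ≤ ∏ i, φ (D ω i)} ≤
      ENNReal.ofReal (Real.exp (-(n * b) - t)) := by
  have hint : ∫⁻ ω, ∏ i, φ (D ω i) ∂μ ≤ ENNReal.ofReal (Real.exp (-(n * b))) := by
    rw [lintegral_prod_eq_prod_lintegral_of_indepFun Finset.univ (fun i ω => φ (D ω i))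
      (hind.comp (fun _ => φ) fun _ => hφ) fun i => hφ.comp (hD i)]
    calc ∏ i, ∫⁻ ω, φ (D ω i) ∂μ = ∏ _i : Fin n, ∫⁻ s, φ s ∂ρ :=
          Finset.prod_congr rfl fun i _ => by rw [← hlaw i, lintegral_map hφ (hD i)]
      _ ≤ ∏ _i : Fin n, ENNReal.ofReal (Real.exp (-b)) := Finset.prod_le_prod' fun _ _ => hb
      _ = ENNReal.ofReal (Real.exp (-(n * b))) := by
          rw [Finset.prod_const, ← ENNReal.ofReal_pow (Real.exp_pos _).le, ← Real.exp_nat_mul]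
          simp
  refine (meas_ge_le_lintegral_div
    (Finset.measurable_prod _ fun i _ => hφ.comp (hD i)).aemeasurable
    (by simpa using Real.exp_pos t) ENNReal.ofReal_ne_top).trans ?_
  refine (ENNReal.div_le_div_right hint _).trans_eq ?_
  rw [← ENNReal.ofReal_div_of_pos (Real.exp_pos _), ← Real.exp_sub]

theorem ae_isLossRatio_sample {lam : ℝ} {φ : Z → ℝ≥0∞} {ℓ₀ ℓ : Z → EReal}
    (hD : ∀ i, Measurable fun ω => D ω i)
    (hlaw : ∀ i, μ.map (fun ω => D ω i) = ρ) (h : ∀ᵐ s ∂ρ, IsLossRatio lam φ ℓ₀ ℓ s) :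
    ∀ᵐ ω ∂μ, ∀ i, IsLossRatio lam φ ℓ₀ ℓ (D ω i) :=
  ae_all_iff.2 fun i => ae_of_ae_map (hD i).aemeasurable (by rwa [hlaw i])

variable [IsProbabilityMeasure μ] {lam : ℝ} {φ : Z → ℝ≥0∞} {ℓ₀ ℓ : Z → EReal}

/-- An infinite competing risk satisfies the inequality trivially; otherwise its failure forces the
product of ratios above exp(lam β). -/
theorem measure_not_sum_le_add_le (hD : ∀ i, Measurable fun ω => D ω i)
    (hlaw : ∀ i, μ.map (fun ω => D ω i) = ρ) (hind : iIndepFun (fun i ω => D ω i) μ)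
    (hφ : Measurable φ) (hlam : 0 ≤ lam) (h : ∀ᵐ s ∂ρ, IsLossRatio lam φ ℓ₀ ℓ s)
    (hint : ∫⁻ s, φ s ∂ρ ≤ 1) (β : ℝ) :
    μ {ω | ¬ ∑ i, ℓ₀ (D ω i) ≤ ∑ i, ℓ (D ω i) + (β : EReal)} ≤
      ENNReal.ofReal (Real.exp (-(lam * β))) := by
  have key := measure_exp_le_prod_le hD hlaw hind hφ (b := 0) (by simpa using hint) (lam * β)
  refine (measure_mono_ae ?_).trans (key.trans_eq (by simp))
  filter_upwards [ae_isLossRatio_sample hD hlaw h] with ω hω hlt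
  obtain ⟨a, ha, hb⟩ := prod_eq_of_isLossRatio hω
  have hlt : ¬ ∑ i, ℓ₀ (D ω i) ≤ ∑ i, ℓ (D ω i) + (β : EReal) := hlt
  change _ ≤ _
  rcases hb with hb | ⟨b, hb, hp⟩
  · rw [ha, hb, EReal.top_add_coe] at hlt
    exact absurd le_top hlt
  · rw [ha, hb, ← EReal.coe_add, EReal.coe_le_coe_iff, not_le] at hlt
    rw [hp]
    refine ENNReal.ofReal_le_ofReal (Real.exp_le_exp.2 (mul_le_mul_of_nonneg_left ?_ hlam))
    linarith

/-- Here an infinite competing risk rules the event out, because the reference risk is finite almost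
surely. -/
theorem measure_sum_le_add_le (hD : ∀ i, Measurable fun ω => D ω i)
    (hlaw : ∀ i, μ.map (fun ω => D ω i) = ρ) (hind : iIndepFun (fun i ω => D ω i) μ)
    (hφ : Measurable φ) (hlam : 0 ≤ lam) (h : ∀ᵐ s ∂ρ, IsLossRatio lam φ ℓ₀ ℓ s) {c : ℝ}
    (hint : ∫⁻ s, φ s ∂ρ ≤ ENNReal.ofReal (Real.exp (-c))) (β : ℝ) :
    μ {ω | ∑ i, ℓ (D ω i) ≤ ∑ i, ℓ₀ (D ω i) + (β : EReal)} ≤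
      ENNReal.ofReal (Real.exp (-(n * c) + lam * β)) := by
  have key := measure_exp_le_prod_le hD hlaw hind hφ hint (-(lam * β))
  refine (measure_mono_ae ?_).trans (key.trans_eq (by rw [sub_neg_eq_add]))
  filter_upwards [ae_isLossRatio_sample hD hlaw h] with ω hω hle
  obtain ⟨a, ha, hb⟩ := prod_eq_of_isLossRatio hω
  have hle : ∑ i, ℓ (D ω i) ≤ ∑ i, ℓ₀ (D ω i) + (β : EReal) := hle
  change _ ≤ _
  rcases hb with hb | ⟨b, hb, hp⟩
  · rw [ha, hb, ← EReal.coe_add] at hle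
    exact absurd (top_le_iff.1 hle) (EReal.coe_ne_top _)
  · rw [ha, hb, ← EReal.coe_add, EReal.coe_le_coe_iff] at hle
    rw [hp, ← mul_neg]
    refine ENNReal.ofReal_le_ofReal (Real.exp_le_exp.2 (mul_le_mul_of_nonneg_left ?_ hlam))
    linarith

end Chernoff

/-! ### One-sample bounds for the two losses -/

section Regression

variable {Z S : Type*} [MeasurableSpace Z] [MeasurableSpace S] {ν : Measure Z}
  [IsProbabilityMeasure ν] {κ : Kernel Z S} [IsMarkovKernel κ] {Y : S → ℝ} {m p : Z → ℝ}

theorem lintegral_ofReal_one_sub_le {g : Z → ℝ} (hg : Measurable g)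
    (hg1 : ∀ z, g z ∈ Set.Icc (0 : ℝ) 1) :
    ∫⁻ z, ENNReal.ofReal (1 - g z) ∂ν ≤ ENNReal.ofReal (Real.exp (-∫ z, g z ∂ν)) := by
  have hi : Integrable g ν := Integrable.of_mem_Icc 0 1 hg.aemeasurable (ae_of_all _ hg1)
  rw [← ofReal_integral_eq_lintegral_ofReal (f := fun z => 1 - g z) ((integrable_const _).sub hi)
    (ae_of_all _ fun z => sub_nonneg.2 (hg1 z).2)]
  refine ENNReal.ofReal_le_ofReal ?_
  rw [integral_sub (integrable_const _) hi]
  simpa using Real.one_sub_le_exp_neg _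

theorem measurable_sqRatio (lam : ℝ) (hY : Measurable Y) (hm : Measurable m) (hp : Measurable p) :
    Measurable (sqRatio lam Y m p) := by
  unfold sqRatio
  fun_prop

/-- With y the mean, the exponent is -λ(q - y)² + 2λ(q - y)(Y - y). Hoeffding's lemma on an interval
of length 2 has variance proxy 1, so the linear part contributes 2λ²(q - y)². -/
theorem lintegral_exp_excess_sq_le {ρ : Measure S} [IsProbabilityMeasure ρ] (hY : Measurable Y)
    (hY2 : ∀ᵐ s ∂ρ, Y s ∈ Set.Icc (0 : ℝ) 2) (lam q : ℝ) :
    ∫⁻ s, ENNReal.ofReal (Real.exp (lam * ((∫ s, Y s ∂ρ - Y s) ^ 2 - (q - Y s) ^ 2))) ∂ρ ≤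
      ENNReal.ofReal (Real.exp ((2 * lam ^ 2 - lam) * (q - ∫ s, Y s ∂ρ) ^ 2)) := by
  set y := ∫ s, Y s ∂ρ with hy
  have hsub := hasSubgaussianMGF_of_mem_Icc hY.aemeasurable hY2
  rw [← hy] at hsub
  have hexp : ∀ s, Real.exp (lam * ((y - Y s) ^ 2 - (q - Y s) ^ 2)) =
      Real.exp (-lam * (q - y) ^ 2) * Real.exp (2 * lam * (q - y) * (Y s - y)) := fun s => by
    rw [← Real.exp_add]; ring_nf
  simp_rw [hexp]
  rw [← ofReal_integral_eq_lintegral_ofReal ((hsub.integrable_exp_mul _).const_mul _)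
    (ae_of_all _ fun _ => by positivity), integral_const_mul]
  refine ENNReal.ofReal_le_ofReal ?_
  refine (mul_le_mul_of_nonneg_left (hsub.mgf_le (2 * lam * (q - y))) (Real.exp_pos _).le).trans ?_
  rw [← Real.exp_add]
  refine Real.exp_le_exp.2 (le_of_eq ?_)
  have : (((‖(2 : ℝ) - 0‖₊ / 2) ^ 2 : NNReal) : ℝ) = 1 := by
    push_cast
    norm_num
  rw [this]
  ring

theorem lintegral_sqRatio_le (hY : Measurable Y) (hm : Measurable m) (hp : Measurable p)
    (hY2 : ∀ z, ∀ᵐ s ∂(κ z), Y s ∈ Set.Icc (0 : ℝ) 2) (hmean : ∀ z, m z = ∫ s, Y s ∂(κ z))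
    (lam : ℝ) : ∫⁻ s, sqRatio lam Y m p s ∂(ν ⊗ₘ κ) ≤
      ∫⁻ z, ENNReal.ofReal (Real.exp ((2 * lam ^ 2 - lam) * (p z - m z) ^ 2)) ∂ν := by
  rw [Measure.lintegral_compProd (measurable_sqRatio lam hY hm hp)]
  refine lintegral_mono fun z => ?_
  have := lintegral_exp_excess_sq_le (ρ := κ z) hY (hY2 z) lam (p z)
  rw [← hmean z] at this
  exact this

/-- λ = 1/2 is the root of 2λ² - λ. -/
theorem lintegral_sqRatio_half_le (hY : Measurable Y) (hm : Measurable m) (hp : Measurable p)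
    (hY2 : ∀ z, ∀ᵐ s ∂(κ z), Y s ∈ Set.Icc (0 : ℝ) 2) (hmean : ∀ z, m z = ∫ s, Y s ∂(κ z)) :
    ∫⁻ s, sqRatio (1 / 2) Y m p s ∂(ν ⊗ₘ κ) ≤ 1 := by
  refine (lintegral_sqRatio_le hY hm hp hY2 hmean _).trans_eq ?_
  norm_num

/-- λ = 1/4 minimizes 2λ² - λ, with value -1/8. Jensen goes the wrong way for pulling the
exponential out of the integral over z, so exp(-u/8) ≤ 1 - u/16 on [0, 1] linearizes it first, at
the price of half the rate. -/
theorem lintegral_sqRatio_quarter_le (hY : Measurable Y) (hm : Measurable m) (hp : Measurable p)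
    (hY2 : ∀ z, ∀ᵐ s ∂(κ z), Y s ∈ Set.Icc (0 : ℝ) 2) (hmean : ∀ z, m z = ∫ s, Y s ∂(κ z))
    (hm1 : ∀ z, m z ∈ Set.Icc (0 : ℝ) 1) (hp1 : ∀ z, p z ∈ Set.Icc (0 : ℝ) 1) :
    ∫⁻ s, sqRatio (1 / 4) Y m p s ∂(ν ⊗ₘ κ) ≤
      ENNReal.ofReal (Real.exp (-((∫ z, (p z - m z) ^ 2 ∂ν) / 16))) := by
  have hd : ∀ z, (p z - m z) ^ 2 ≤ 1 := fun z => by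
    rw [sq_le_one_iff_abs_le_one, abs_le]
    constructor <;> linarith [(hm1 z).1, (hm1 z).2, (hp1 z).1, (hp1 z).2]
  refine (lintegral_sqRatio_le hY hm hp hY2 hmean _).trans ?_
  rw [← integral_div]
  refine le_trans (lintegral_mono fun z => ENNReal.ofReal_le_ofReal ?_)
    (lintegral_ofReal_one_sub_le (g := fun z => (p z - m z) ^ 2 / 16) (by fun_prop) fun z =>
      ⟨by positivity, by linarith [hd z]⟩)
  set u := (p z - m z) ^ 2 with hu
  have hu0 : 0 ≤ u := by positivity
  have hu1 : u ≤ 1 := hd z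
  have h1 := Real.add_one_le_exp (u / 8)
  have h2 : Real.exp ((2 * (1 / 4 : ℝ) ^ 2 - 1 / 4) * u) = (Real.exp (u / 8))⁻¹ := by
    rw [← Real.exp_neg]; ring_nf
  rw [h2]
  refine inv_le_of_inv_le₀ (by linarith) ((inv_le_of_inv_le₀ (by positivity) ?_).trans h1)
  rw [inv_le_iff_one_le_mul₀ (by positivity)]
  nlinarith

theorem measurable_bceRatio (hY : Measurable Y) (hm : Measurable m) (hp : Measurable p) :
    Measurable (bceRatio Y m p) := by
  unfold bceRatio
  fun_prop

theorem mul_sqrt_div (a : ℝ) {b : ℝ} (hb : 0 ≤ b) : b * √(a / b) = √(b * a) := by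
  rcases hb.eq_or_lt with rfl | hb'
  · simp
  · rw [Real.sqrt_div' _ hb, Real.sqrt_mul hb]
    field_simp
    rw [Real.sq_sqrt hb, mul_comm]

/-- The left side equals 1 minus half of both squared differences of roots; the one for 1 - a and 1
- b is dropped. -/
theorem sqrt_mul_add_sqrt_mul_le {a b : ℝ} (ha : a ∈ Set.Icc (0 : ℝ) 1)
    (hb : b ∈ Set.Icc (0 : ℝ) 1) :
    √(a * b) + √((1 - a) * (1 - b)) ≤ 1 - (√b - √a) ^ 2 / 2 := by
  have ha1 : 0 ≤ 1 - a := sub_nonneg.2 ha.2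
  have hb1 : 0 ≤ 1 - b := sub_nonneg.2 hb.2
  rw [Real.sqrt_mul ha.1, Real.sqrt_mul ha1]
  nlinarith [sq_nonneg (√(1 - a) - √(1 - b)), Real.sq_sqrt ha.1, Real.sq_sqrt hb.1,
    Real.sq_sqrt ha1, Real.sq_sqrt hb1]

/-- Weighted AM-GM makes the ratio affine in Y, so a target anywhere in [0, 1] behaves like a
Bernoulli variable of mean m. The conditional expectation is then at most the affinity √(mp) +
√((1-m)(1-p)). -/
theorem lintegral_bceRatio_le (hY : Measurable Y) (hm : Measurable m) (hp : Measurable p)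
    (hY1 : ∀ᵐ z ∂ν, ∀ᵐ s ∂(κ z), Y s ∈ Set.Icc (0 : ℝ) 1) (hmean : ∀ z, m z = ∫ s, Y s ∂(κ z))
    (hm1 : ∀ z, m z ∈ Set.Icc (0 : ℝ) 1) (hp1 : ∀ z, p z ∈ Set.Icc (0 : ℝ) 1) :
    ∫⁻ s, bceRatio Y m p s ∂(ν ⊗ₘ κ) ≤
      ENNReal.ofReal (Real.exp (-((∫ z, (√(p z) - √(m z)) ^ 2 ∂ν) / 2))) := by
  rw [Measure.lintegral_compProd (measurable_bceRatio hY hm hp), ← integral_div]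
  refine le_trans (lintegral_mono_ae ?_)
    (lintegral_ofReal_one_sub_le (g := fun z => (√(p z) - √(m z)) ^ 2 / 2) (by fun_prop) fun z =>
      ⟨by positivity, ?_⟩)
  · filter_upwards [hY1] with z hz
    have hYi : Integrable Y (κ z) := Integrable.of_mem_Icc 0 1 hY.aemeasurable hz
    set P := √(p z / m z)
    set Q := √((1 - p z) / (1 - m z))
    have hle : ∀ᵐ s ∂(κ z), bceRatio Y m p (z, s) ≤
        ENNReal.ofReal (Y s * P + (1 - Y s) * Q) := by
      filter_upwards [hz] with s hs
      exact ENNReal.ofReal_le_ofReal (Real.geom_mean_le_arith_mean2_weighted hs.1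
        (sub_nonneg.2 hs.2) (Real.sqrt_nonneg _) (Real.sqrt_nonneg _) (by ring))
    have hi1 : Integrable (fun s => Y s * P) (κ z) := hYi.mul_const _
    have hi2 : Integrable (fun s => (1 - Y s) * Q) (κ z) :=
      ((integrable_const _).sub hYi).mul_const _
    refine (lintegral_mono_ae hle).trans ?_
    rw [← ofReal_integral_eq_lintegral_ofReal (f := fun s => Y s * P + (1 - Y s) * Q)
      (hi1.add hi2) (by
      filter_upwards [hz] with s hs
      exact add_nonneg (mul_nonneg hs.1 (Real.sqrt_nonneg _))
        (mul_nonneg (sub_nonneg.2 hs.2) (Real.sqrt_nonneg _)))]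
    refine ENNReal.ofReal_le_ofReal ?_
    rw [integral_add hi1 hi2, integral_mul_const, integral_mul_const,
      integral_sub (integrable_const _) hYi, ← hmean z]
    simp only [integral_const, probReal_univ, smul_eq_mul, mul_one]
    rw [mul_sqrt_div _ (hm1 z).1, mul_sqrt_div _ (sub_nonneg.2 (hm1 z).2)]
    exact sqrt_mul_add_sqrt_mul_le (hm1 z) (hp1 z)
  · have h1 := Real.sqrt_nonneg (p z)
    have h2 := Real.sqrt_nonneg (m z)
    have h3 := Real.sqrt_le_one.2 (hp1 z).2
    have h4 := Real.sqrt_le_one.2 (hm1 z).2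
    nlinarith

/-- A [0, 1]-valued variable whose mean is an endpoint equals it almost surely. This keeps the
cross-entropy of the conditional mean finite. -/
theorem ae_mean_endpoints (hY : Measurable Y) (hm : Measurable m)
    (hY1 : ∀ᵐ z ∂ν, ∀ᵐ s ∂(κ z), Y s ∈ Set.Icc (0 : ℝ) 1) (hmean : ∀ z, m z = ∫ s, Y s ∂(κ z)) :
    ∀ᵐ s ∂(ν ⊗ₘ κ), Y s.2 ∈ Set.Icc (0 : ℝ) 1 ∧ (m s.1 = 0 → Y s.2 = 0) ∧
      (1 - m s.1 = 0 → 1 - Y s.2 = 0) := by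
  have hY' : Measurable fun s : Z × S => Y s.2 := by fun_prop
  have hm' : Measurable fun s : Z × S => m s.1 := by fun_prop
  refine (Measure.ae_compProd_iff ?_).2 ?_
  · refine (hY' measurableSet_Icc).inter (MeasurableSet.inter ?_ ?_)
    · exact MeasurableSet.imp (measurableSet_eq_fun hm' measurable_const)
        (measurableSet_eq_fun hY' measurable_const)
    · exact MeasurableSet.imp (measurableSet_eq_fun (hm'.const_sub 1) measurable_const)
        (measurableSet_eq_fun (hY'.const_sub 1) measurable_const)
  · filter_upwards [hY1] with z hz
    have hYi : Integrable Y (κ z) := Integrable.of_mem_Icc 0 1 hY.aemeasurable hz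
    have e0 : m z = 0 → ∀ᵐ s ∂(κ z), Y s = 0 := fun h =>
      (integral_eq_zero_iff_of_nonneg_ae (hz.mono fun _ h => h.1) hYi).1 (by rw [← hmean, h])
    have e1 : 1 - m z = 0 → ∀ᵐ s ∂(κ z), 1 - Y s = 0 := fun h =>
      (integral_eq_zero_iff_of_nonneg_ae (hz.mono fun _ h => sub_nonneg.2 h.2)
        ((integrable_const _).sub hYi)).1 (by
          rw [integral_sub (integrable_const _) hYi, ← hmean]; simpa using h)
    by_cases c0 : m z = 0
    · have c1 : 1 - m z ≠ 0 := by rw [c0]; norm_num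
      filter_upwards [hz, e0 c0] with s h1 h2 using ⟨h1, fun _ => h2, fun h => absurd h c1⟩
    · by_cases c1 : 1 - m z = 0
      · filter_upwards [hz, e1 c1] with s h1 h2 using ⟨h1, fun h => absurd h c0, fun _ => h2⟩
      · filter_upwards [hz] with s h1 using ⟨h1, fun h => absurd h c0, fun h => absurd h c1⟩

end Regression

/-! ### Which coordinates of a tuple its greedy policy's step-h problem depends on -/

section Dependence

theorem returnLaw_congr (M : MDP X A) {π π' : Policy X A} (k : ℕ) {h : ℕ}
    (hπ : ∀ j, h < j → π.act j = π'.act j) : returnLaw M π k h = returnLaw M π' k h := by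
  induction k generalizing h with
  | zero => rfl
  | succ k ih =>
    rw [returnLaw, returnLaw, ih fun j hj => hπ j (by omega), hπ (h + 1) (by omega)]

theorem qValue_congr (M : MDP X A) (H : ℕ) {π π' : Policy X A} {h : ℕ}
    (hπ : ∀ j, h < j → π.act j = π'.act j) : qValue M H π h = qValue M H π' h := by
  ext z
  rw [qValue, qValue, returnLaw_congr M _ hπ]

theorem empRisk_congr {n : ℕ} {loss : ℝ → ℝ → EReal} {π π' : Policy X A} {h : ℕ}
    (hπ : π.act (h + 1) = π'.act (h + 1)) (p g : X × A → ℝ) (D : Fin n → (X × A) × (ℝ × X)) :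
    empRisk loss π h p g D = empRisk loss π' h p g D := by
  simp only [empRisk, target, Policy.avg, hπ]

theorem act_policy_update (G : GreedyRule H F) (f : ℕ → X × A → ℝ) (h : ℕ) (g : X × A → ℝ)
    {j : ℕ} (hj : h < j) : (G.policy (Function.update f h g)).act j = (G.policy f).act j := by
  simp only [GreedyRule.policy, Function.update_of_ne hj.ne']

end Dependence

/-! ### The union bound -/

section UnionBound

/-- With N replaced by c, the first term is δ - δ/c and the second is δ³/(H²c) ≤ δ/c. -/
theorem union_bound_le {H N c δ β : ℝ} (hH : 1 ≤ H) (hN : 1 ≤ N) (hNc : N ≤ c) (hδ0 : 0 < δ)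
    (hδ1 : δ < 1) (hβ : β = 2 * Real.log (H * c / δ)) :
    H * ((N - 1) * Real.exp (-(β / 2))) + H * (N * (N * Real.exp (-(3 * β / 2)))) ≤ δ := by
  have hc : 1 ≤ c := hN.trans hNc
  have he : Real.exp (-(β / 2)) = δ / (H * c) := by
    rw [hβ, mul_div_cancel_left₀ _ two_ne_zero, Real.exp_neg, Real.exp_log (by positivity),
      inv_div]
  have he3 : Real.exp (-(3 * β / 2)) = (δ / (H * c)) ^ 3 := by
    rw [← he, ← Real.exp_nat_mul]
    push_cast
    ring_nf
  rw [he, he3]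
  have h1 : H * ((N - 1) * (δ / (H * c))) ≤ H * ((c - 1) * (δ / (H * c))) := by gcongr
  have h2 : H * (N * (N * (δ / (H * c)) ^ 3)) ≤ H * (c * (c * (δ / (H * c)) ^ 3)) := by gcongr
  have h3 : H * ((c - 1) * (δ / (H * c))) = δ - δ / c := by field_simp
  have h4 : H * (c * (c * (δ / (H * c)) ^ 3)) = (δ / c) * (δ ^ 2 / H ^ 2) := by field_simp
  have h5 : δ ^ 2 / H ^ 2 ≤ 1 := by
    rw [div_le_one (by positivity)]
    exact pow_le_pow_left₀ hδ0.le (hδ1.le.trans hH) 2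
  have h6 := mul_le_mul_of_nonneg_left h5 (div_pos hδ0 (by linarith : 0 < c)).le
  linarith

variable {n : ℕ} {Ω : Type w} [MeasurableSpace Ω] {μ : Measure Ω}
  {D : Ω → ℕ → Fin n → (X × A) × (ℝ × X)}

theorem measure_biUnion_le_ofReal {ι : Type*} (s : Finset ι) {B : ι → Set Ω} {r : ℝ}
    (hB : ∀ i ∈ s, μ (B i) ≤ ENNReal.ofReal r) :
    μ (⋃ i ∈ s, B i) ≤ ENNReal.ofReal (s.card * r) := by
  refine (measure_biUnion_finset_le s B).trans ((Finset.sum_le_card_nsmul _ _ _ hB).trans_eq ?_)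
  rw [ENNReal.ofReal_mul (Nat.cast_nonneg _), ENNReal.ofReal_natCast, nsmul_eq_mul]

/-- On the good event the true value functions lie in all version spaces, and the members of the
version spaces have small Bellman errors. -/
def GoodEvent (M : MDP X A) (loss : ℝ → ℝ → EReal) (β : ℝ) (H : ℕ)
    (F : ℕ → Finset (X × A → ℝ)) (Pi : Set (Policy X A))
    (err : ℕ → (X × A → ℝ) → (X × A → ℝ) → ℝ) (ε : ℝ)
    (d : ℕ → Fin n → (X × A) × (ℝ × X)) : Prop :=
  (∀ π ∈ Pi, qValue M H π ∈ versionSpace loss β H F d π) ∧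
  ∀ π ∈ Pi, ∀ f ∈ versionSpace loss β H F d π, ∀ h < H,
    err h (f h) (bellman M π h (f (h + 1))) ≤ ε

theorem measure_not_goodEvent_le {M : MDP X A} (hH : 0 < H) (hne : (tuples H F).Nonempty)
    {G : GreedyRule H F} (hBC : BellmanComplete M H F G.policies) {δ β : ℝ} (hδ0 : 0 < δ)
    (hδ1 : δ < 1) (hβ : β = 2 * Real.log (H * classCard H F / δ)) {loss : ℝ → ℝ → EReal}
    {err : ℕ → (X × A → ℝ) → (X × A → ℝ) → ℝ} {ε : ℝ}
    (tail1 : ∀ π ∈ G.policies, ∀ f ∈ tuples H F, ∀ h < H, ∀ p ∈ F h,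
      μ {ω | ¬ empRisk loss π h (bellman M π h (f (h + 1))) (f (h + 1)) (D ω h) ≤
        empRisk loss π h p (f (h + 1)) (D ω h) + (β : EReal)} ≤
          ENNReal.ofReal (Real.exp (-(β / 2))))
    (tail2 : ∀ π ∈ G.policies, ∀ f ∈ tuples H F, ∀ h < H,
      μ {ω | empRisk loss π h (f h) (f (h + 1)) (D ω h) ≤
          empRisk loss π h (bellman M π h (f (h + 1))) (f (h + 1)) (D ω h) + (β : EReal) ∧
        ¬ err h (f h) (bellman M π h (f (h + 1))) ≤ ε} ≤
          ENNReal.ofReal (Real.exp (-(3 * β / 2)))) :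
    μ {ω | ¬ GoodEvent M loss β H F G.policies err ε (D ω)} ≤ ENNReal.ofReal δ := by
  classical
  have hβ0 := threshold_nonneg hH hne hδ0 hδ1 hβ
  obtain ⟨f₀, hf₀⟩ := id hne
  have hpol : ∀ f ∈ tuples H F, G.policy f ∈ G.policies := fun f hf => ⟨f, hf, rfl⟩
  have hq : ∀ f ∈ tuples H F, qValue M H (G.policy f) ∈ tuples H F := fun f hf =>
    qValue_mem_tuples hne hBC (hpol f hf)
  set T := tupleFinset H F with hT
  have hTmem : ∀ f, f ∈ T ↔ f ∈ tuples H F := fun f => mem_tupleFinset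
  -- The step-h coordinate of `t h` is the Q-function of its own greedy policy, so in `B1 h (t h)` a
  -- risk competes with itself; β ≥ 0 makes that event empty.
  set t : ℕ → ℕ → X × A → ℝ := fun h =>
    Function.update f₀ h (qValue M H (G.policy f₀) h) with ht
  have htmem : ∀ h < H, t h ∈ tuples H F := fun h hh =>
    update_mem_tuples hf₀ hh ((hq f₀ hf₀).1 h hh)
  -- `f` plays two roles: its coordinates after h fix the policy that matters, and `f h` is the
  -- competitor. A pair (f, g) is thus covered by the tuple `Function.update f h g`.
  set B1 : ℕ → (ℕ → X × A → ℝ) → Set Ω := fun h f =>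
    {ω | ¬ empRisk loss (G.policy f) h (qValue M H (G.policy f) h)
        (qValue M H (G.policy f) (h + 1)) (D ω h) ≤
      empRisk loss (G.policy f) h (f h) (qValue M H (G.policy f) (h + 1)) (D ω h) + (β : EReal)}
    with hB1
  set B2 : ℕ → (ℕ → X × A → ℝ) → (ℕ → X × A → ℝ) → Set Ω := fun h g f =>
    {ω | empRisk loss (G.policy g) h (f h) (f (h + 1)) (D ω h) ≤
        empRisk loss (G.policy g) h (bellman M (G.policy g) h (f (h + 1))) (f (h + 1)) (D ω h) +
          (β : EReal) ∧
      ¬ err h (f h) (bellman M (G.policy g) h (f (h + 1))) ≤ ε} with hB2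
  have hsub : {ω | ¬ GoodEvent M loss β H F G.policies err ε (D ω)} ⊆
      (⋃ h ∈ Finset.range H, ⋃ f ∈ T.erase (t h), B1 h f) ∪
        ⋃ h ∈ Finset.range H, ⋃ g ∈ T, ⋃ f ∈ T, B2 h g f := by
    intro ω hω
    by_contra hnot
    rw [Set.mem_union, not_or] at hnot
    simp only [Set.mem_iUnion, not_exists, Finset.mem_range] at hnot
    obtain ⟨hn1, hn2⟩ := hnot
    refine hω ⟨?_, ?_⟩
    · rintro _ ⟨f, hf, rfl⟩
      refine mem_versionSpace_iff.2 ⟨hq f hf, fun h hh g hg => ?_⟩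
      have hu := update_mem_tuples hf hh hg
      have hact : ∀ j, h < j →
          (G.policy (Function.update f h g)).act j = (G.policy f).act j := fun j hj =>
        act_policy_update G f h g hj
      have hgood : ω ∉ B1 h (Function.update f h g) := by
        by_cases hEq : Function.update f h g = t h
        · rw [hEq]
          have hth : t h h = qValue M H (G.policy (t h)) h := by
            rw [qValue_congr M H fun j hj => act_policy_update G f₀ h _ hj]
            simp [ht]
          intro hω'
          apply hω'
          rw [← hth]
          exact le_add_of_nonneg_right (by exact_mod_cast hβ0)
        · exact hn1 h hh _ (Finset.mem_erase.2 ⟨hEq, (hTmem _).2 hu⟩)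
      have hle := not_not.1 hgood
      rw [qValue_congr M H hact, qValue_congr M H (h := h + 1) fun j hj => hact j (by omega),
        empRisk_congr (hact _ (Nat.lt_succ_self h)), empRisk_congr (hact _ (Nat.lt_succ_self h)),
        Function.update_self] at hle
      exact hle
    · rintro _ ⟨g, hg, rfl⟩ f hf h hh
      by_contra herr
      obtain ⟨hft, hfv⟩ := mem_versionSpace_iff.1 hf
      exact hn2 h hh g ((hTmem g).2 hg) f ((hTmem f).2 hft)
        ⟨hfv h hh _ (hBC _ (hpol g hg) f hft h hh), herr⟩
  have hcard : ∀ h ∈ Finset.range H, ((T.erase (t h)).card : ℝ) = T.card - 1 := fun h hh => by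
    have hm := (hTmem _).2 (htmem h (Finset.mem_range.1 hh))
    rw [Finset.card_erase_of_mem hm, Nat.cast_pred (Finset.card_pos.2 ⟨_, hm⟩)]
  have hm1 : μ (⋃ h ∈ Finset.range H, ⋃ f ∈ T.erase (t h), B1 h f) ≤
      ENNReal.ofReal (H * ((T.card - 1) * Real.exp (-(β / 2)))) := by
    refine (measure_biUnion_le_ofReal (Finset.range H)
      (r := (T.card - 1) * Real.exp (-(β / 2))) fun h hh => ?_).trans_eq
        (by rw [Finset.card_range])
    rw [← hcard h hh]
    refine measure_biUnion_le_ofReal _ fun f hf => ?_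
    have hft := (hTmem f).1 (Finset.mem_of_mem_erase hf)
    have hh := Finset.mem_range.1 hh
    have := tail1 (G.policy f) (hpol f hft) _ (hq f hft) h hh (f h) (hft.1 h hh)
    rw [← qValue_eq_bellman M _ hh] at this
    exact this
  have hm2 : μ (⋃ h ∈ Finset.range H, ⋃ g ∈ T, ⋃ f ∈ T, B2 h g f) ≤
      ENNReal.ofReal (H * (T.card * (T.card * Real.exp (-(3 * β / 2))))) := by
    refine (measure_biUnion_le_ofReal (Finset.range H)
      (r := T.card * (T.card * Real.exp (-(3 * β / 2)))) fun h hh => ?_).trans_eq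
        (by rw [Finset.card_range])
    refine measure_biUnion_le_ofReal _ fun g hg => measure_biUnion_le_ofReal _ fun f hf => ?_
    exact tail2 _ (hpol g ((hTmem g).1 hg)) f ((hTmem f).1 hf) h (Finset.mem_range.1 hh)
  have hT1 : (1 : ℝ) ≤ T.card := by
    exact_mod_cast Finset.card_pos.2 ⟨f₀, (hTmem f₀).2 hf₀⟩
  refine (measure_mono hsub).trans ((measure_union_le _ _).trans ((add_le_add hm1 hm2).trans ?_))
  rw [← ENNReal.ofReal_add (by have := sub_nonneg.2 hT1; positivity) (by positivity)]
  exact ENNReal.ofReal_le_ofReal (union_bound_le (by exact_mod_cast hH) hT1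
    (by exact_mod_cast card_tupleFinset_le) hδ0 hδ1 hβ)

end UnionBound

/-! ### Tail bounds for the two losses at one step -/

section Tails

variable {M : MDP X A} {ν : ℕ → Measure (X × A)} [∀ h, IsProbabilityMeasure (ν h)]
  {n : ℕ} {Ω : Type w} [MeasurableSpace Ω] {μ : Measure Ω} [IsProbabilityMeasure μ]
  {d : Ω → Fin n → (X × A) × (ℝ × X)} {h : ℕ} {π : Policy X A} {g p : X × A → ℝ} {β : ℝ}

/-- The regression target as a function of cost and successor state. -/
def costTarget (π : Policy X A) (h : ℕ) (g : X × A → ℝ) (s : ℝ × X) : ℝ :=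
  s.1 + π.avg (h + 1) g s.2

theorem measurable_costTarget (hg : Measurable g) : Measurable (costTarget π h g) :=
  measurable_fst.add ((measurable_avg π (h + 1) hg).comp measurable_snd)

theorem ae_costTarget_mem (hg : Measurable g) (hg1 : ∀ z, g z ∈ Set.Icc (0 : ℝ) 1) (z : X × A) :
    ∀ᵐ s ∂((M.cost h ×ₖ M.trans h) z), costTarget π h g s ∈ Set.Icc (0 : ℝ) 2 := by
  rw [Kernel.prod_apply]
  filter_upwards [(Measure.quasiMeasurePreserving_fst (ν := M.trans h z)).ae (M.cost_mem h z)]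
    with s hs
  have := avg_mem_Icc π (h + 1) hg hg1 s.2
  exact ⟨add_nonneg hs.1 this.1, by unfold costTarget; linarith [hs.2, this.2]⟩

theorem sq_tail_bellman (hd : ∀ i, Measurable fun ω => d ω i)
    (hlaw : ∀ i, μ.map (fun ω => d ω i) = dataLaw M ν h)
    (hind : iIndepFun (fun i ω => d ω i) μ) (hg : Measurable g)
    (hg1 : ∀ z, g z ∈ Set.Icc (0 : ℝ) 1) (hT : Measurable (bellman M π h g)) (hp : Measurable p) :
    μ {ω | ¬ empRisk sqLoss π h (bellman M π h g) g (d ω) ≤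
      empRisk sqLoss π h p g (d ω) + (β : EReal)} ≤ ENNReal.ofReal (Real.exp (-(β / 2))) := by
  have hY := measurable_costTarget (π := π) (h := h) hg
  refine (measure_not_sum_le_add_le hd hlaw hind (measurable_sqRatio (1 / 2) hY hT hp)
    (by norm_num) (ae_of_all _ (sqLoss_isLossRatio (1 / 2) (costTarget π h g) _ p))
    (lintegral_sqRatio_half_le hY hT hp (ae_costTarget_mem hg hg1) fun _ => rfl) β).trans_eq ?_
  ring_nf

theorem sq_tail_error (hn : 0 < n) (hd : ∀ i, Measurable fun ω => d ω i)
    (hlaw : ∀ i, μ.map (fun ω => d ω i) = dataLaw M ν h)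
    (hind : iIndepFun (fun i ω => d ω i) μ) (hg : Measurable g)
    (hg1 : ∀ z, g z ∈ Set.Icc (0 : ℝ) 1) (hT : Measurable (bellman M π h g))
    (hT1 : ∀ z, bellman M π h g z ∈ Set.Icc (0 : ℝ) 1) (hp : Measurable p)
    (hp1 : ∀ z, p z ∈ Set.Icc (0 : ℝ) 1) :
    μ {ω | empRisk sqLoss π h p g (d ω) ≤
        empRisk sqLoss π h (bellman M π h g) g (d ω) + (β : EReal) ∧
      ¬ sqErr (ν h) p (bellman M π h g) ≤ 28 * (β / n)} ≤
        ENNReal.ofReal (Real.exp (-(3 * β / 2))) := by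
  -- The error is deterministic: either the event is empty or Chernoff applies. In the latter case n
  -- · err/16 > 7β/4, and subtracting β/4 leaves 3β/2, whence 28.
  by_cases herr : sqErr (ν h) p (bellman M π h g) ≤ 28 * (β / n)
  · simp [herr]
  have hY := measurable_costTarget (π := π) (h := h) hg
  refine (measure_mono fun ω hω => hω.1).trans
    ((measure_sum_le_add_le hd hlaw hind (measurable_sqRatio (1 / 4) hY hT hp)
    (by norm_num) (ae_of_all _ (sqLoss_isLossRatio (1 / 4) (costTarget π h g) _ p))
    (lintegral_sqRatio_quarter_le hY hT hp (ae_costTarget_mem hg hg1) (fun _ => rfl)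
      hT1 hp1) β).trans ?_)
  refine ENNReal.ofReal_le_ofReal (Real.exp_le_exp.2 ?_)
  have hn' : (0 : ℝ) < n := by exact_mod_cast hn
  rw [not_le, ← mul_div_assoc, div_lt_iff₀ hn'] at herr
  rw [sqErr] at herr
  linarith

theorem ae_costTarget_mem_Icc_zero_one (hg : Measurable g)
    (hg1 : ∀ z, g z ∈ Set.Icc (0 : ℝ) 1) (hY1 : ∀ᵐ s ∂(dataLaw M ν h), target π h g s ≤ 1) :
    ∀ᵐ z ∂(ν h), ∀ᵐ s ∂((M.cost h ×ₖ M.trans h) z),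
      costTarget π h g s ∈ Set.Icc (0 : ℝ) 1 := by
  filter_upwards [Measure.ae_ae_of_ae_compProd hY1] with z hz
  filter_upwards [hz, ae_costTarget_mem (π := π) hg hg1 z] with s hs hs' using ⟨hs'.1, hs⟩

theorem ae_bceLoss_isLossRatio (hg : Measurable g)
    (hg1 : ∀ z, g z ∈ Set.Icc (0 : ℝ) 1) (hY1 : ∀ᵐ s ∂(dataLaw M ν h), target π h g s ≤ 1)
    (hT : Measurable (bellman M π h g)) (hT1 : ∀ z, bellman M π h g z ∈ Set.Icc (0 : ℝ) 1)
    (hp1 : ∀ z, p z ∈ Set.Icc (0 : ℝ) 1) :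
    ∀ᵐ s ∂(dataLaw M ν h), IsLossRatio (1 / 2) (bceRatio (costTarget π h g) (bellman M π h g) p)
      (fun s => bceLoss (bellman M π h g s.1) (costTarget π h g s.2))
      (fun s => bceLoss (p s.1) (costTarget π h g s.2)) s := by
  filter_upwards [ae_mean_endpoints (ν := ν h) (κ := M.cost h ×ₖ M.trans h)
    (measurable_costTarget hg) hT (ae_costTarget_mem_Icc_zero_one hg hg1 hY1) fun _ => rfl]
    with s hs using bceLoss_isLossRatio (hT1 _) (hp1 _) hs.1 hs.2.1 hs.2.2

theorem bce_tail_bellman (hd : ∀ i, Measurable fun ω => d ω i)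
    (hlaw : ∀ i, μ.map (fun ω => d ω i) = dataLaw M ν h)
    (hind : iIndepFun (fun i ω => d ω i) μ) (hg : Measurable g)
    (hg1 : ∀ z, g z ∈ Set.Icc (0 : ℝ) 1) (hY1 : ∀ᵐ s ∂(dataLaw M ν h), target π h g s ≤ 1)
    (hT : Measurable (bellman M π h g)) (hT1 : ∀ z, bellman M π h g z ∈ Set.Icc (0 : ℝ) 1)
    (hp : Measurable p) (hp1 : ∀ z, p z ∈ Set.Icc (0 : ℝ) 1) :
    μ {ω | ¬ empRisk bceLoss π h (bellman M π h g) g (d ω) ≤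
      empRisk bceLoss π h p g (d ω) + (β : EReal)} ≤ ENNReal.ofReal (Real.exp (-(β / 2))) := by
  have hY := measurable_costTarget (π := π) (h := h) hg
  have hint := lintegral_bceRatio_le hY hT hp (ae_costTarget_mem_Icc_zero_one hg hg1 hY1)
    (fun _ => rfl) hT1 hp1
  refine (measure_not_sum_le_add_le hd hlaw hind (measurable_bceRatio hY hT hp) (by norm_num)
    (ae_bceLoss_isLossRatio hg hg1 hY1 hT hT1 hp1) (hint.trans ?_) β).trans_eq ?_
  · refine ENNReal.ofReal_le_one.2 (Real.exp_le_one_iff.2 (neg_nonpos.2 ?_))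
    exact div_nonneg (integral_nonneg fun _ => sq_nonneg _) zero_le_two
  · ring_nf

theorem bce_tail_error (hn : 0 < n) (hd : ∀ i, Measurable fun ω => d ω i)
    (hlaw : ∀ i, μ.map (fun ω => d ω i) = dataLaw M ν h)
    (hind : iIndepFun (fun i ω => d ω i) μ) (hg : Measurable g)
    (hg1 : ∀ z, g z ∈ Set.Icc (0 : ℝ) 1) (hY1 : ∀ᵐ s ∂(dataLaw M ν h), target π h g s ≤ 1)
    (hT : Measurable (bellman M π h g)) (hT1 : ∀ z, bellman M π h g z ∈ Set.Icc (0 : ℝ) 1)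
    (hp : Measurable p) (hp1 : ∀ z, p z ∈ Set.Icc (0 : ℝ) 1) :
    μ {ω | empRisk bceLoss π h p g (d ω) ≤
        empRisk bceLoss π h (bellman M π h g) g (d ω) + (β : EReal) ∧
      ¬ hellErr (ν h) p (bellman M π h g) ≤ 4 * (β / n)} ≤
        ENNReal.ofReal (Real.exp (-(3 * β / 2))) := by
  -- As for the squared loss: n · err/2 > 2β, and subtracting β/2 leaves 3β/2.
  by_cases herr : hellErr (ν h) p (bellman M π h g) ≤ 4 * (β / n)
  · simp [herr]
  have hY := measurable_costTarget (π := π) (h := h) hg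
  have hint := lintegral_bceRatio_le hY hT hp (ae_costTarget_mem_Icc_zero_one hg hg1 hY1)
    (fun _ => rfl) hT1 hp1
  refine (measure_mono fun ω hω => hω.1).trans
    ((measure_sum_le_add_le hd hlaw hind (measurable_bceRatio hY hT hp) (by norm_num)
      (ae_bceLoss_isLossRatio hg hg1 hY1 hT hT1 hp1) hint β).trans ?_)
  refine ENNReal.ofReal_le_ofReal (Real.exp_le_exp.2 ?_)
  have hn' : (0 : ℝ) < n := by exact_mod_cast hn
  rw [not_le, ← mul_div_assoc, div_lt_iff₀ hn'] at herr
  rw [hellErr] at herr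
  linarith

end Tails

/-! ### Regret on the good event -/

section Guarantees

variable {M : MDP X A} {ν : ℕ → Measure (X × A)} [∀ h, IsProbabilityMeasure (ν h)]
  {Pi : Set (Policy X A)} {n : ℕ} {β : ℝ} {d : ℕ → Fin n → (X × A) × (ℝ × X)}

theorem policies_finite (G : GreedyRule H F) : G.policies.Finite :=
  finite_tuples.image _

theorem GoodEvent.exists_isOutput {loss : ℝ → ℝ → EReal}
    {err : ℕ → (X × A → ℝ) → (X × A → ℝ) → ℝ} {ε : ℝ} (hPf : Pi.Finite) (hPn : Pi.Nonempty)
    (hgood : GoodEvent M loss β H F Pi err ε d) : ∃ πhat, IsOutput M loss β H F Pi d πhat :=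
  OfflineRL.exists_isOutput hPf hPn fun π hπ => ⟨_, hgood.1 π hπ⟩

theorem GoodEvent.sq_regret {loss : ℝ → ℝ → EReal} (hF : UnitClasses H F)
    (hBC : BellmanComplete M H F Pi)
    (hgood : GoodEvent M loss β H F Pi (fun h => sqErr (ν h)) (28 * (β / n)) d)
    {πhat πc : Policy X A} (hout : IsOutput M loss β H F Pi d πhat) (hπc : πc ∈ Pi)
    (hC : coverage M H ν πc ≠ ∞) :
    value M H πhat - value M H πc ≤ 16 * (H * √((coverage M H ν πc).toReal * β / n)) := by
  obtain ⟨f, hf, hle⟩ := hout.exists_value_le hgood.1 hπc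
  have hft := hf.1
  have hT := hBC πc hπc f hft
  have key := avg_sub_value_le_of_sqErr (M := M) (π := πc) hF hft hT
    (ε := 28 * ((coverage M H ν πc).toReal * β / n)) fun h hh => by
      have hm := hF.meas h hh _ (hT h hh)
      have h1 := hF.mem h hh _ (hT h hh)
      have hf1 := hF.mem_Icc hft h
      have hfm := hF.measurable hft h
      refine (integral_le_mul_of_le_smul hC (visit_le_coverage_smul M hC hh) (b := 1)
        (by fun_prop) (fun _ => sq_nonneg _) fun z => ?_).trans ?_
      · rw [sq_le_one_iff_abs_le_one, abs_le]
        constructor <;> linarith [(h1 z).1, (h1 z).2, (hf1 z).1, (hf1 z).2]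
      · refine (mul_le_mul_of_nonneg_left (hgood.2 πc hπc f hf h hh)
          ENNReal.toReal_nonneg).trans_eq ?_
        ring
  have h28 : √(28 * ((coverage M H ν πc).toReal * β / n)) ≤
      16 * √((coverage M H ν πc).toReal * β / n) := by
    rw [Real.sqrt_mul (by norm_num)]
    refine mul_le_mul_of_nonneg_right (Real.sqrt_le_iff.2 ?_) (Real.sqrt_nonneg _)
    norm_num
  have := mul_le_mul_of_nonneg_left h28 (Nat.cast_nonneg (α := ℝ) H)
  linarith

theorem GoodEvent.bce_regret {loss : ℝ → ℝ → EReal} (hF : UnitClasses H F) (hβ : 0 ≤ β)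
    (hBC : BellmanComplete M H F Pi)
    (hgood : GoodEvent M loss β H F Pi (fun h => hellErr (ν h)) (4 * (β / n)) d)
    {πhat πc : Policy X A} (hout : IsOutput M loss β H F Pi d πhat) (hπc : πc ∈ Pi)
    (hC : coverage M H ν πc ≠ ∞) :
    value M H πhat - value M H πc ≤
      16 * (H * √(value M H πc * ((coverage M H ν πc).toReal * β / n)) +
        H ^ 2 * ((coverage M H ν πc).toReal * β / n)) := by
  obtain ⟨f, hf, hle⟩ := hout.exists_value_le hgood.1 hπc
  have hft := hf.1
  have hT := hBC πc hπc f hft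
  have key := avg_sub_value_le_of_hellErr (M := M) (π := πc) hF hft hT
    (ε := (coverage M H ν πc).toReal * β / n) (by positivity) fun h hh => by
      have hm := hF.meas h hh _ (hT h hh)
      have h1 := hF.mem h hh _ (hT h hh)
      have hf1 := hF.mem_Icc hft h
      have hfm := hF.measurable hft h
      refine (integral_le_mul_of_le_smul hC (visit_le_coverage_smul M hC hh) (b := 1)
        (by fun_prop) (fun _ => sq_nonneg _) fun z => ?_).trans ?_
      · rw [sq_le_one_iff_abs_le_one, abs_le]
        constructor <;> linarith [Real.sqrt_nonneg (f h z), Real.sqrt_le_one.2 (hf1 z).2,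
          Real.sqrt_nonneg (bellman M πc h (f (h + 1)) z), Real.sqrt_le_one.2 (h1 z).2]
      · refine (mul_le_mul_of_nonneg_left (hgood.2 πc hπc f hf h hh)
          ENNReal.toReal_nonneg).trans_eq ?_
        ring
  linarith

end Guarantees

end OfflineRL

end

theorem mainTheorem7 :
    ∃ K : ℝ, 0 < K ∧
      ∀ (X : Type u) (A : Type v) [MeasurableSpace X] [MeasurableSpace A]
        (M : MDP X A) (H : ℕ) (_hH : 0 < H)
        (F : ℕ → Finset (X × A → ℝ))
        (_hFne : (tuples H F).Nonempty)
        (_hFmeas : ∀ h < H, ∀ f ∈ F h, Measurable f)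
        (_hFmem : ∀ h < H, ∀ f ∈ F h, ∀ z, f z ∈ Set.Icc (0 : ℝ) 1)
        (G : GreedyRule H F)
        (_hBC : BellmanComplete M H F G.policies)
        (ν : ℕ → Measure (X × A)) [∀ h, IsProbabilityMeasure (ν h)]
        (n : ℕ) (_hn : 0 < n)
        (Ω : Type w) [MeasurableSpace Ω] (μ : Measure Ω) [IsProbabilityMeasure μ]
        (D : Ω → ℕ → Fin n → (X × A) × (ℝ × X))
        (_hDmeas : ∀ h < H, ∀ i, Measurable (fun ω => D ω h i))
        (_hDlaw : ∀ h < H, ∀ i, μ.map (fun ω => D ω h i) = dataLaw M ν h)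
        (_hDindep : ∀ h < H, iIndepFun (fun i ω => D ω h i) μ)
        (δ : ℝ) (_hδ0 : 0 < δ) (_hδ1 : δ < 1)
        (β : ℝ) (_hβ : β = 2 * Real.log (H * classCard H F / δ)),
      -- squared loss
      μ {ω | ¬ ((∃ πhat, IsOutput M sqLoss β H F G.policies (D ω) πhat) ∧
          ∀ πhat, IsOutput M sqLoss β H F G.policies (D ω) πhat →
          ∀ πc ∈ G.policies, coverage M H ν πc ≠ ∞ →
            value M H πhat - value M H πc ≤
              K * (H * √((coverage M H ν πc).toReal * β / n)))} ≤ ENNReal.ofReal δ ∧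
      -- binary cross-entropy loss, for regression targets in `[0, 1]`
      ((∀ h < H, ∀ f ∈ tuples H F, ∀ π ∈ G.policies,
          ∀ᵐ s ∂(dataLaw M ν h), target π h (f (h + 1)) s ≤ 1) →
        μ {ω | ¬ ((∃ πhat, IsOutput M bceLoss β H F G.policies (D ω) πhat) ∧
          ∀ πhat, IsOutput M bceLoss β H F G.policies (D ω) πhat →
          ∀ πc ∈ G.policies, coverage M H ν πc ≠ ∞ →
            value M H πhat - value M H πc ≤
              K * (H * √(value M H πc * ((coverage M H ν πc).toReal * β / n)) +
                H ^ 2 * ((coverage M H ν πc).toReal * β / n)))} ≤ ENNReal.ofReal δ) := by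

  -- 16 is dictated by `first_order_bound`; the squared loss only needs √28.
  refine ⟨16, by norm_num, ?_⟩
  intro X A _ _ M H hH F hne hmeas hmem G hBC ν _ n hn Ω _ μ _ D hDm hDl hDi δ hδ0 hδ1 β hβ
  have hF : UnitClasses H F := ⟨hmeas, hmem⟩
  have hPn : G.policies.Nonempty := hne.image _
  have hPf := policies_finite G
  refine ⟨?_, fun hY1 => ?_⟩
  · refine le_trans (measure_mono (Set.ofPred_subset_ofPred.2 fun ω => mt fun hgood => ⟨?_, ?_⟩))
      (measure_not_goodEvent_le (loss := sqLoss) (err := fun h => sqErr (ν h))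
        (ε := 28 * (β / n)) (D := D) hH hne hBC hδ0 hδ1 hβ ?_ ?_)
    · exact GoodEvent.exists_isOutput hPf hPn hgood
    · exact fun πhat hout πc hπc hC => GoodEvent.sq_regret hF hBC hgood hout hπc hC
    · intro π hπ f hf h hh p hp
      exact sq_tail_bellman (hDm h hh) (hDl h hh) (hDi h hh) (hF.measurable hf _)
        (hF.mem_Icc hf _) (hmeas h hh _ (hBC π hπ f hf h hh)) (hmeas h hh p hp)
    · intro π hπ f hf h hh
      have hT := hBC π hπ f hf h hh
      exact sq_tail_error hn (hDm h hh) (hDl h hh) (hDi h hh) (hF.measurable hf _)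
        (hF.mem_Icc hf _) (hmeas h hh _ hT) (hmem h hh _ hT) (hF.measurable hf _)
        (hF.mem_Icc hf _)
  · refine le_trans (measure_mono (Set.ofPred_subset_ofPred.2 fun ω => mt fun hgood => ⟨?_, ?_⟩))
      (measure_not_goodEvent_le (loss := bceLoss) (err := fun h => hellErr (ν h))
        (ε := 4 * (β / n)) (D := D) hH hne hBC hδ0 hδ1 hβ ?_ ?_)
    · exact GoodEvent.exists_isOutput hPf hPn hgood
    · exact fun πhat hout πc hπc hC => GoodEvent.bce_regret hF
        (threshold_nonneg hH hne hδ0 hδ1 hβ) hBC hgood hout hπc hC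
    · intro π hπ f hf h hh p hp
      have hT := hBC π hπ f hf h hh
      exact bce_tail_bellman (hDm h hh) (hDl h hh) (hDi h hh) (hF.measurable hf _)
        (hF.mem_Icc hf _) (hY1 h hh f hf π hπ) (hmeas h hh _ hT) (hmem h hh _ hT)
        (hmeas h hh p hp) (hmem h hh p hp)
    · intro π hπ f hf h hh
      have hT := hBC π hπ f hf h hh
      exact bce_tail_error hn (hDm h hh) (hDl h hh) (hDi h hh) (hF.measurable hf _)
        (hF.mem_Icc hf _) (hY1 h hh f hf π hπ) (hmeas h hh _ hT) (hmem h hh _ hT)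
        (hF.measurable hf _) (hF.mem_Icc hf _)
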